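/- \textbf{Setting.} Fix circuit parameters $\boldsymbol\Omega=(\omega_{\rm b},C_{\rm f},L_{\rm f},R_{\rm f},L,R)\in\mathbb R^6_{>0}$, design constants $K_{\rm VC},K_{\rm CC},\mu_{\rm d},\mu_{\rm q},\Gamma_{\rm d},\Gamma_{\rm q},\varepsilon,\omega_{\rm pc},\omega_{\rm qc},c,I_{\max}>0$, $\xi_{\rm p},\xi_{\rm q}>1$, saturation levels $\overline P,\overline Q\in(0,+\infty]$, and $\omega_0,V_0,P_0,Q_0,K_{\rm P},K_{\rm Q}\in\mathbb R$. The state is $(\boldsymbol x,z_{\rm d},z_{\rm q})$ with $\boldsymbol x=(v_{\rm c,d},v_{\rm c,q},i_{\rm t,d},i_{\rm t,q},i_{\rm g,d},i_{\rm g,q},q_1,q_2,p_1,p_2)\in\mathbb R^{10}$; write $\boldsymbol v_{\rm c}=(v_{\rm c,d},v_{\rm c,q})$, $\boldsymbol i_{\rm t}=(i_{\rm t,d},i_{\rm t,q})$, and let $\boldsymbol x'\in\mathbb R^8$ be $\boldsymbol x$ without the components $i_{\rm t,d},i_{\rm t,q}$. Put $p=v_{\rm c,d}i_{\rm g,d}+v_{\rm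 c,q}i_{\rm g,q}$, $q=v_{\rm c,q}i_{\rm g,d}-v_{\rm c,d}i_{\rm g,q}$, $\omega=\omega_0+K_{\rm P}(P_0-p_1)$, $v^{\rm r}_{\rm c,d}=V_0+K_{\rm Q}(Q_0-q_1)$, and $\operatorname{sat}_X(y)=\max\{-X,\min\{y,X\}\}$. Given the grid voltage $(v_{\rm g,d},v_{\rm g,q})$ and the terminal voltage $\boldsymbol v_{\rm t}=(v_{\rm t,d},v_{\rm t,q})$, the plant is \begin{align*} \dot v_{\rm c,d}&=\omega_{\rm b}\omega v_{\rm c,q}+\tfrac{\omega_{\rm b}}{C_{\rm f}}(i_{\rm t,d}-i_{\rm g,d}),& \dot v_{\rm c,q}&=-\omega_{\rm b}\omega v_{\rm c,d}+\tfrac{\omega_{\rm b}}{C_{\rm f}}(i_{\rm t,q}-i_{\rm g,q}),\\ \dot i_{\rm t,d}&=\omega_{\rm b}\omega i_{\rm t,q}+\tfrac{\omega_{\rm b}}{L_{\rm f}}(v_{\rm t,d}-v_{\rm c,d})-\tfrac{\omega_{\rm b}R_{\rm f}}{L_{\rm f}}i_{\rm t,d},& \dot i_{\rm t,q}&=-\omega_{\rm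 b}\omega i_{\rm t,d}+\tfrac{\omega_{\rm b}}{L_{\rm f}}(v_{\rm t,q}-v_{\rm c,q})-\tfrac{\omega_{\rm b}R_{\rm f}}{L_{\rm f}}i_{\rm t,q},\\ \dot i_{\rm g,d}&=\omega_{\rm b}\omega i_{\rm g,q}+\tfrac{\omega_{\rm b}}{L}(v_{\rm c,d}-v_{\rm g,d})-\tfrac{\omega_{\rm b}R}{L}i_{\rm g,d},& \dot i_{\rm g,q}&=-\omega_{\rm b}\omega i_{\rm g,d}+\tfrac{\omega_{\rm b}}{L}(v_{\rm c,q}-v_{\rm g,q})-\tfrac{\omega_{\rm b}R}{L}i_{\rm g,q},\\ \dot q_1&=q_2,&\dot q_2&=-2\xi_{\rm q}\omega_{\rm qc}q_2-\omega_{\rm qc}^2\big(q_1-\operatorname{sat}_{\overline Q}(q)\big),\\ \dot p_1&=p_2,&\dot p_2&=-2\xi_{\rm p}\omega_{\rm pc}p_2-\omega_{\rm pc}^2\big(p_1-\operatorname{sat}_{\overline P}(p)\big). \end{align*} \textbf{Nominal controller (DADS-BS).} Let $e_{\rm d}=v_{\rm c,d}-v^{\rm r}_{\rm c,d}$, $i^{\rm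 r}_{\rm t,d}=i_{\rm g,d}-C_{\rm f}\omega v_{\rm c,q}-\frac{C_{\rm f}K_{\rm Q}}{\omega_{\rm b}}q_2-\frac{C_{\rm f}K_{\rm VC}}{\omega_{\rm b}}e_{\rm d}$, $i^{\rm r}_{\rm t,q}=i_{\rm g,q}+C_{\rm f}\omega v_{\rm c,d}-\frac{C_{\rm f}K_{\rm VC}}{\omega_{\rm b}}v_{\rm c,q}$, and \begin{align*} u_{\rm d}&=-\Big(K_{\rm CC}+\tfrac{(1+e^{z_{\rm d}})\omega_{\rm b}^2}{4\mu_{\rm d}}(1+i_{\rm g,d}^2+v_{\rm c,d}^2)\Big)(i_{\rm t,d}-i^{\rm r}_{\rm t,d})-\tfrac{\omega_{\rm b}}{C_{\rm f}}e_{\rm d},\\ u_{\rm q}&=-\Big(K_{\rm CC}+\tfrac{(1+e^{z_{\rm q}})\omega_{\rm b}^2}{4\mu_{\rm q}}(1+i_{\rm g,q}^2+v_{\rm c,q}^2)\Big)(i_{\rm t,q}-i^{\rm r}_{\rm t,q})-\tfrac{\omega_{\rm b}}{C_{\rm f}}v_{\rm c,q},\\ v^{\rm n}_{\rm t,d}&=\tfrac{L_{\rm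 f}}{\omega_{\rm b}}\Big[-2\omega_{\rm b}\omega(i_{\rm t,q}-i_{\rm g,q})+\tfrac{\omega_{\rm b}R_{\rm f}}{L_{\rm f}}i_{\rm t,d}+\omega_{\rm b}\big(\tfrac1{L_{\rm f}}+\omega^2C_{\rm f}\big)v_{\rm c,d}+C_{\rm f}K_{\rm P}p_2v_{\rm c,q}-K_{\rm VC}(i_{\rm t,d}-i^{\rm r}_{\rm t,d})\\ &\qquad+\tfrac{C_{\rm f}K_{\rm VC}^2}{\omega_{\rm b}}e_{\rm d}+\tfrac{2\xi_{\rm q}\omega_{\rm qc}K_{\rm Q}C_{\rm f}}{\omega_{\rm b}}q_2+\tfrac{\omega_{\rm qc}^2K_{\rm Q}C_{\rm f}}{\omega_{\rm b}}\big(q_1-\operatorname{sat}_{\overline Q}(q)\big)+u_{\rm d}\Big],\\ v^{\rm n}_{\rm t,q}&=\tfrac{L_{\rm f}}{\omega_{\rm b}}\Big[2\omega_{\rm b}\omega(i_{\rm t,d}-i_{\rm g,d})+\tfrac{\omega_{\rm b}R_{\rm f}}{L_{\rm f}}i_{\rm t,q}+\omega_{\rm b}\big(\tfrac1{L_{\rm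 f}}+C_{\rm f}\omega^2+\tfrac{C_{\rm f}K_{\rm VC}^2}{\omega_{\rm b}^2}\big)v_{\rm c,q}-C_{\rm f}K_{\rm P}p_2v_{\rm c,d}-K_{\rm VC}(i_{\rm t,q}-i^{\rm r}_{\rm t,q})+u_{\rm q}\Big], \end{align*} with adaptive gains $\dot z_\ell=\Gamma_\ell e^{-z_\ell}\max\{W_\ell-\varepsilon,0\}$ for $\ell\in\{{\rm d},{\rm q}\}$, where $W_{\rm d}=\frac12e_{\rm d}^2+\frac12(i_{\rm t,d}-i^{\rm r}_{\rm t,d})^2$ and $W_{\rm q}=\frac12v_{\rm c,q}^2+\frac12(i_{\rm t,q}-i^{\rm r}_{\rm t,q})^2$. \textbf{Safety filter.} With $h=I_{\max}^2-\|\boldsymbol i_{\rm t}\|^2$, $\boldsymbol v^{\rm n}_{\rm t}=(v^{\rm n}_{\rm t,d},v^{\rm n}_{\rm t,q})$, $A=\begin{bmatrix}-\frac{R_{\rm f}}{L_{\rm f}}\omega_{\rm b}&\omega_{\rm b}\omega\\-\omega_{\rm b}\omega&-\frac{R_{\rm f}}{L_{\rm f}}\omega_{\rm b}\end{bmatrix}$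 and \[\eta=-2\boldsymbol i_{\rm t}^\top A\boldsymbol i_{\rm t}+\tfrac{2\omega_{\rm b}}{L_{\rm f}}\boldsymbol i_{\rm t}^\top\boldsymbol v_{\rm c}-\tfrac{2\omega_{\rm b}}{L_{\rm f}}\boldsymbol i_{\rm t}^\top\boldsymbol v^{\rm n}_{\rm t}+c\,h,\] the implemented voltage is $\boldsymbol v_{\rm t}=\boldsymbol v^{\rm n}_{\rm t}$ if $\eta\ge0$, and $\boldsymbol v_{\rm t}=\boldsymbol v^{\rm n}_{\rm t}+\frac{L_{\rm f}}{2\omega_{\rm b}}\frac{\eta}{\|\boldsymbol i_{\rm t}\|^2}\boldsymbol i_{\rm t}$ otherwise. The safe set is $\mathcal C=\{\boldsymbol x: i_{\rm t,d}^2+i_{\rm t,q}^2\le I_{\max}^2\}$. Along a solution, the ON episodes are the maximal intervals contained in $\{t\ge0:\eta(t)<0\}$; $N_\eta\in\mathbb N\cup\{\infty\}$ is their number and $T_\eta\in[0,\infty]$ their total length. \textbf{Theorem.} There exist a continuous function $B_{2}:\mathbb R^{10}\times\mathbb R_+\times\mathbb R_+\to\mathbb R_+$ and a function $B_{3}:\mathbb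 R^{10}\times\mathbb R\times\mathbb R\times\mathbb R_+\times\mathbb R_+\times\mathbb N\times\mathbb R_+\to\mathbb R_+$ (depending on the fixed parameters) such that for all $v_{\rm g,d},v_{\rm g,q}\in L^\infty(\mathbb R_+;\mathbb R)$, all $\boldsymbol x(0)\in\mathcal C$ and all $z_{\rm d}(0),z_{\rm q}(0)\in\mathbb R$, the closed loop has a unique absolutely continuous solution on $[0,\infty)$ with this initial condition, and for all $t\ge0$ \[\sqrt{i_{\rm t,d}(t)^2+i_{\rm t,q}(t)^2}\le I_{\max},\qquad \|\boldsymbol x'(t)\|\le B_2\big(\boldsymbol x(0),\|v_{\rm g,d}\|_\infty,\|v_{\rm g,q}\|_\infty\big).\] Moreover, whenever $N\in\mathbb N$ and $T\in[0,\infty)$ satisfy $N_\eta\le N$ and $T_\eta\le T$ for this solution, then for each $\ell\in\{{\rm d},{\rm q}\}$ the gain $z_\ell$ is non-decreasing, $\lim_{s\to\infty}z_\ell(s)$ exists and is finite, and for all $t\ge0$ \[z_\ell(0)\le z_\ell(t)\le\lim_{s\to\infty}z_\ell(s)\le B_3\big(\boldsymbol x(0),z_{\rm d}(0),z_{\rm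 q}(0),\|v_{\rm g,d}\|_\infty,\|v_{\rm g,q}\|_\infty,N,T\big).\] -/

import Mathlib

open scoped NNReal ENNReal Matrix
open MeasureTheory Set Filter Topology

noncomputable section

namespace GFM

/-- The constant physical parameters `Ω = (ω_b, C_f, L_f, R_f, L, R)`, all positive. -/
structure Circuit where
  ωb : ℝ
  Cf : ℝ
  Lf : ℝ
  Rf : ℝ
  L : ℝ
  R : ℝ
  ωb_pos : 0 < ωb
  Cf_pos : 0 < Cf
  Lf_pos : 0 < Lf
  Rf_pos : 0 < Rf
  L_pos : 0 < L
  R_pos : 0 < R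

/-- Design parameters of the DADS-BS controller, the power filters and the safety filter,
with the setpoints and the droop coefficients. The saturation thresholds lie in `(0, +∞]`. -/
structure Design where
  KVC : ℝ
  KCC : ℝ
  μd : ℝ
  μq : ℝ
  Γd : ℝ
  Γq : ℝ
  ε : ℝ
  ωpc : ℝ
  ωqc : ℝ
  ξp : ℝ
  ξq : ℝ
  Pbar : EReal
  Qbar : EReal
  ω₀ : ℝ
  V₀ : ℝ
  P₀ : ℝ
  Q₀ : ℝ
  KP : ℝ
  KQ : ℝ
  Imax : ℝ
  /-- the gain of the linear barrier condition `ḣ ≥ -c h` -/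
  c : ℝ
  KVC_pos : 0 < KVC
  KCC_pos : 0 < KCC
  μd_pos : 0 < μd
  μq_pos : 0 < μq
  Γd_pos : 0 < Γd
  Γq_pos : 0 < Γq
  ε_pos : 0 < ε
  ωpc_pos : 0 < ωpc
  ωqc_pos : 0 < ωqc
  one_lt_ξp : 1 < ξp
  one_lt_ξq : 1 < ξq
  Pbar_pos : 0 < Pbar
  Qbar_pos : 0 < Qbar
  Imax_pos : 0 < Imax
  c_pos : 0 < c

/-- The physical state
`x = (v_cd, v_cq, i_td, i_tq, i_gd, i_gq, q₁, q₂, p₁, p₂) ∈ ℝ¹⁰` (Euclidean norm). -/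
abbrev State := EuclideanSpace ℝ (Fin 10)

/-- The closed-loop state `(x, z_d, z_q)`. -/
abbrev FullState := State × ℝ × ℝ

namespace State

def vcd (x : State) : ℝ := x 0
def vcq (x : State) : ℝ := x 1
def itd (x : State) : ℝ := x 2
def itq (x : State) : ℝ := x 3
def igd (x : State) : ℝ := x 4
def igq (x : State) : ℝ := x 5
def q₁ (x : State) : ℝ := x 6
def q₂ (x : State) : ℝ := x 7
def p₁ (x : State) : ℝ := x 8
def p₂ (x : State) : ℝ := x 9

/-- PCC voltage vector. -/
def vc (x : State) : Fin 2 → ℝ := ![x.vcd, x.vcq]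

/-- Terminal current vector. -/
def it (x : State) : Fin 2 → ℝ := ![x.itd, x.itq]

/-- Instantaneous active power. -/
def p (x : State) : ℝ := x.vcd * x.igd + x.vcq * x.igq

/-- Instantaneous reactive power. -/
def q (x : State) : ℝ := x.vcq * x.igd - x.vcd * x.igq

/-- The states other than the terminal current,
`x' = (v_cd, v_cq, i_gd, i_gq, q₁, q₂, p₁, p₂) ∈ ℝ⁸` (Euclidean norm). -/
def rest (x : State) : EuclideanSpace ℝ (Fin 8) :=
  !₂[x.vcd, x.vcq, x.igd, x.igq, x.q₁, x.q₂, x.p₁, x.p₂]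

end State

/-- Saturation at the level `X ∈ (0, +∞]`. -/
def sat (X : EReal) (y : ℝ) : ℝ :=
  open Classical in
  if X < (y : EReal) then X.toReal
  else if (y : EReal) < -X then -X.toReal
  else y

/-! ### Droop laws -/

/-- Reference for the d-axis PCC voltage; the q-axis reference is zero. -/
def vcdRef (D : Design) (x : State) : ℝ := D.V₀ + D.KQ * (D.Q₀ - x.q₁)

/-- Per-unit electrical frequency. -/
def freq (D : Design) (x : State) : ℝ := D.ω₀ + D.KP * (D.P₀ - x.p₁)

/-! ### The DADS-BS controller -/

/-- Reference for the d-axis terminal current. -/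
def itdRef (Ω : Circuit) (D : Design) (x : State) : ℝ :=
  x.igd - Ω.Cf * freq D x * x.vcq - Ω.Cf * D.KQ / Ω.ωb * x.q₂
    - Ω.Cf * D.KVC / Ω.ωb * (x.vcd - vcdRef D x)

/-- Reference for the q-axis terminal current. -/
def itqRef (Ω : Circuit) (D : Design) (x : State) : ℝ :=
  x.igq + Ω.Cf * freq D x * x.vcd - Ω.Cf * D.KVC / Ω.ωb * x.vcq

def ud (Ω : Circuit) (D : Design) (x : State) (zd : ℝ) : ℝ :=
  -(D.KCC + (1 + Real.exp zd) * Ω.ωb ^ 2 / (4 * D.μd) * (1 + x.igd ^ 2 + x.vcd ^ 2))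
      * (x.itd - itdRef Ω D x)
    - Ω.ωb / Ω.Cf * (x.vcd - vcdRef D x)

def uq (Ω : Circuit) (D : Design) (x : State) (zq : ℝ) : ℝ :=
  -(D.KCC + (1 + Real.exp zq) * Ω.ωb ^ 2 / (4 * D.μq) * (1 + x.igq ^ 2 + x.vcq ^ 2))
      * (x.itq - itqRef Ω D x)
    - Ω.ωb / Ω.Cf * x.vcq

/-- Nominal d-axis terminal voltage. -/
def vtdNom (Ω : Circuit) (D : Design) (x : State) (zd : ℝ) : ℝ :=
  Ω.Lf / Ω.ωb *
    (-2 * Ω.ωb * freq D x * (x.itq - x.igq) + Ω.ωb * Ω.Rf / Ω.Lf * x.itd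
      + Ω.ωb * (1 / Ω.Lf + freq D x ^ 2 * Ω.Cf) * x.vcd + Ω.Cf * D.KP * x.p₂ * x.vcq
      - D.KVC * (x.itd - itdRef Ω D x) + Ω.Cf * D.KVC ^ 2 / Ω.ωb * (x.vcd - vcdRef D x)
      + 2 * D.ξq * D.ωqc * D.KQ * Ω.Cf / Ω.ωb * x.q₂
      + D.ωqc ^ 2 * D.KQ * Ω.Cf / Ω.ωb * (x.q₁ - sat D.Qbar x.q)
      + ud Ω D x zd)

/-- Nominal q-axis terminal voltage. -/
def vtqNom (Ω : Circuit) (D : Design) (x : State) (zq : ℝ) : ℝ :=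
  Ω.Lf / Ω.ωb *
    (2 * Ω.ωb * freq D x * (x.itd - x.igd) + Ω.ωb * Ω.Rf / Ω.Lf * x.itq
      + Ω.ωb * (1 / Ω.Lf + Ω.Cf * freq D x ^ 2 + Ω.Cf * D.KVC ^ 2 / Ω.ωb ^ 2) * x.vcq
      - Ω.Cf * D.KP * x.p₂ * x.vcd
      - D.KVC * (x.itq - itqRef Ω D x)
      + uq Ω D x zq)

/-- The DADS-BS control as a nominal terminal-voltage vector. -/
def vtNom (Ω : Circuit) (D : Design) (y : FullState) : Fin 2 → ℝ :=
  ![vtdNom Ω D y.1 y.2.1, vtqNom Ω D y.1 y.2.2]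

/-- The d-axis energy signal driving the adaptation. -/
def Wd (Ω : Circuit) (D : Design) (x : State) : ℝ :=
  1 / 2 * (x.vcd - vcdRef D x) ^ 2 + 1 / 2 * (x.itd - itdRef Ω D x) ^ 2

/-- The q-axis energy signal driving the adaptation. -/
def Wq (Ω : Circuit) (D : Design) (x : State) : ℝ :=
  1 / 2 * x.vcq ^ 2 + 1 / 2 * (x.itq - itqRef Ω D x) ^ 2

/-! ### The safety filter -/

/-- The current-limiting barrier function. -/
def barrier (D : Design) (x : State) : ℝ := D.Imax ^ 2 - x.it ⬝ᵥ x.it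

/-- The safe set `𝒞`. -/
def safeSet (D : Design) : Set State := {x | x.itd ^ 2 + x.itq ^ 2 ≤ D.Imax ^ 2}

/-- The matrix `A(x)` of the terminal-current dynamics. -/
def A (Ω : Circuit) (D : Design) (x : State) : Matrix (Fin 2) (Fin 2) ℝ :=
  !![-(Ω.Rf / Ω.Lf * Ω.ωb), Ω.ωb * freq D x;
     -(Ω.ωb * freq D x), -(Ω.Rf / Ω.Lf * Ω.ωb)]

/-- `η(x, vn)`, the slack of the barrier condition under the control `vn`. -/
def eta (Ω : Circuit) (D : Design) (x : State) (vn : Fin 2 → ℝ) : ℝ :=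
  -2 * (x.it ⬝ᵥ (A Ω D x *ᵥ x.it)) + 2 * Ω.ωb / Ω.Lf * (x.it ⬝ᵥ x.vc)
    - 2 * Ω.ωb / Ω.Lf * (x.it ⬝ᵥ vn) + D.c * barrier D x

/-- The safety filter: the implemented terminal voltage for the nominal voltage `vn`. -/
def safetyFilter (Ω : Circuit) (D : Design) (x : State) (vn : Fin 2 → ℝ) : Fin 2 → ℝ :=
  open Classical in
  if 0 ≤ eta Ω D x vn then vn
  else vn + (Ω.Lf / (2 * Ω.ωb) * (eta Ω D x vn / (x.it ⬝ᵥ x.it))) • x.it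

/-! ### Dynamics -/

/-- Right-hand side of the circuit and power-filter dynamics, with terminal voltage `vt` and
grid voltage `(vgd, vgq)`. -/
def plantField (Ω : Circuit) (D : Design) (vgd vgq : ℝ) (vt : Fin 2 → ℝ) (x : State) : State :=
  !₂[Ω.ωb * freq D x * x.vcq + Ω.ωb / Ω.Cf * (x.itd - x.igd),
     -Ω.ωb * freq D x * x.vcd + Ω.ωb / Ω.Cf * (x.itq - x.igq),
     Ω.ωb * freq D x * x.itq + Ω.ωb / Ω.Lf * (vt 0 - x.vcd) - Ω.ωb * Ω.Rf / Ω.Lf * x.itd,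
     -Ω.ωb * freq D x * x.itd + Ω.ωb / Ω.Lf * (vt 1 - x.vcq) - Ω.ωb * Ω.Rf / Ω.Lf * x.itq,
     Ω.ωb * freq D x * x.igq + Ω.ωb / Ω.L * (x.vcd - vgd) - Ω.ωb * Ω.R / Ω.L * x.igd,
     -Ω.ωb * freq D x * x.igd + Ω.ωb / Ω.L * (x.vcq - vgq) - Ω.ωb * Ω.R / Ω.L * x.igq,
     x.q₂,
     -2 * D.ξq * D.ωqc * x.q₂ - D.ωqc ^ 2 * (x.q₁ - sat D.Qbar x.q),
     x.p₂,
     -2 * D.ξp * D.ωpc * x.p₂ - D.ωpc ^ 2 * (x.p₁ - sat D.Pbar x.p)]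

/-- Right-hand side of the closed loop with the safety-filtered DADS-BS control. -/
def closedLoopField (Ω : Circuit) (D : Design) (vgd vgq : ℝ) (y : FullState) : FullState :=
  (plantField Ω D vgd vgq (safetyFilter Ω D y.1 (vtNom Ω D y)) y.1,
   D.Γd * Real.exp (-y.2.1) * max (Wd Ω D y.1 - D.ε) 0,
   D.Γq * Real.exp (-y.2.2) * max (Wq Ω D y.1 - D.ε) 0)

/-- `y` is an absolutely continuous solution of the closed loop on `[0, ∞)`: it is absolutely
continuous on every `[0, T]` and satisfies the differential equation for almost every time. Only
the values of `y`, `vgd`, `vgq` at nonnegative times matter. -/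
structure IsSolution (Ω : Circuit) (D : Design) (vgd vgq : ℝ → ℝ) (y : ℝ → FullState) :
    Prop where
  absCont : ∀ T : ℝ, 0 ≤ T → AbsolutelyContinuousOnInterval y 0 T
  ode : ∀ᵐ t ∂(volume.restrict (Ici (0 : ℝ))),
    HasDerivAt y (closedLoopField Ω D (vgd t) (vgq t) (y t)) t

/-! ### Grid voltage signals -/

/-- `v ∈ L^∞(ℝ₊; ℝ)`. -/
def IsBoundedSignal (v : ℝ → ℝ) : Prop := MemLp v ⊤ (volume.restrict (Ici (0 : ℝ)))

/-- `‖v‖_∞`, the essential supremum of `|v|` on `ℝ₊`. -/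
def supNorm (v : ℝ → ℝ) : ℝ≥0 := (eLpNorm v ⊤ (volume.restrict (Ici (0 : ℝ)))).toNNReal

/-! ### Activation of the safety filter -/

/-- The set of times at which the safety filter is active along `y`. -/
def onSet (Ω : Circuit) (D : Design) (y : ℝ → FullState) : Set ℝ :=
  {t | 0 ≤ t ∧ eta Ω D (y t).1 (vtNom Ω D (y t)) < 0}

/-- The ON episodes: the maximal intervals contained in the ON set. -/
def episodes (Ω : Circuit) (D : Design) (y : ℝ → FullState) : Set (Set ℝ) :=
  (fun t => ordConnectedComponent (onSet Ω D y) t) '' onSet Ω D y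

/-- `N_η`, the number of ON episodes, possibly infinite. -/
def episodeCount (Ω : Circuit) (D : Design) (y : ℝ → FullState) : ℕ∞ :=
  (episodes Ω D y).encard

/-- `T_η`, the sum of the lengths of the ON episodes, possibly infinite. -/
def totalOnTime (Ω : Circuit) (D : Design) (y : ℝ → FullState) : ℝ≥0∞ :=
  ∑' J : episodes Ω D y, volume (J : Set ℝ)

/-- The asserted behaviour of an adaptive gain: `z` is non-decreasing on `[0, ∞)` and converges
to a finite limit, with `z 0 ≤ z t ≤ lim z ≤ B` for all `t ≥ 0`. -/
def GainBoundedBy (z : ℝ → ℝ) (B : ℝ) : Prop :=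
  MonotoneOn z (Ici 0) ∧
    ∃ l : ℝ, Tendsto z atTop (𝓝 l) ∧ (∀ t : ℝ, 0 ≤ t → z 0 ≤ z t ∧ z t ≤ l) ∧ l ≤ B

end GFM

end

/-!
The grid voltage enters the closed loop additively, so subtracting its primitive leaves an ordinary
differential equation with continuous right-hand side and locally Lipschitz state dependence: the
safety filter is continuous at `iₜ = 0` because its slack is positive there. Local solutions
continue to `[0, ∞)` once they are bounded on bounded intervals.

The filter enforces `ḣ ≥ -c h`, whence the bound on the terminal current. The current then bounds
the energy stored in the capacitor and the grid inductor, this energy bounds the powers, and the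
powers drive overdamped second-order filters; each stage is bounded by the previous one.

For the gains, `e^z` is `Γ` times the integral of the excess energy `max (W - ε) 0`. While the
filter is off, nonlinear damping gives `Ẇ ≤ -σ W + ϑ / (1 + e^z)`, so as soon as `e^z` exceeds
`ϑ / (σ ε)` the excess energy decays exponentially, except during the ON episodes, each of which
can raise it by at most its upper bound. Hence its integral over all later times is finite.
-/

/-! ### Absolutely continuous functions -/

section AbsolutelyContinuous

theorem absolutelyContinuousOnInterval_comp_of_lipschitzOnWith {X Y : Type*}
    [PseudoMetricSpace X] [PseudoMetricSpace Y] {f : ℝ → X} {g : X → Y} {a b : ℝ} {K : ℝ≥0}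
    {s : Set X} (hf : AbsolutelyContinuousOnInterval f a b) (hg : LipschitzOnWith K g s)
    (hs : MapsTo f (uIcc a b) s) : AbsolutelyContinuousOnInterval (fun t => g (f t)) a b := by
  unfold AbsolutelyContinuousOnInterval at hf ⊢
  refine squeeze_zero' (.of_forall fun E => Finset.sum_nonneg fun i _ => dist_nonneg)
    (eventually_inf_principal.2 (.of_forall fun E hE => ?_))
    (by simpa only [mul_zero] using hf.const_mul (K : ℝ))
  rw [Finset.mul_sum]
  refine Finset.sum_le_sum fun i hi => ?_
  obtain ⟨hleft, hright⟩ := hE.1 i hi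
  exact hg.dist_le_mul _ (hs hleft) _ (hs hright)

theorem absolutelyContinuousOnInterval_comp_of_locallyLipschitz {E Y : Type*}
    [SeminormedAddCommGroup E] [PseudoMetricSpace Y] {f : ℝ → E} {g : E → Y} {a b : ℝ}
    (hf : AbsolutelyContinuousOnInterval f a b) (hg : LocallyLipschitz g) :
    AbsolutelyContinuousOnInterval (fun t => g (f t)) a b := by
  obtain ⟨K, hK⟩ := (hg.locallyLipschitzOn (s := f '' uIcc a b)).exists_lipschitzOnWith_of_compact
    (isCompact_uIcc.image_of_continuousOn hf.continuousOn)
  exact absolutelyContinuousOnInterval_comp_of_lipschitzOnWith hf hK (mapsTo_image _ _)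

theorem absolutelyContinuousOnInterval_congr {X : Type*} [PseudoMetricSpace X] {f g : ℝ → X}
    {a b : ℝ} (hf : AbsolutelyContinuousOnInterval f a b) (h : EqOn f g (uIcc a b)) :
    AbsolutelyContinuousOnInterval g a b := by
  refine Tendsto.congr' (eventually_inf_principal.2 (.of_forall fun E hE => ?_)) hf
  exact Finset.sum_congr rfl fun i hi => by rw [h (hE.1 i hi).1, h (hE.1 i hi).2]

theorem deriv_norm_le_norm_of_hasDerivAt {E : Type*} [NormedAddCommGroup E] [NormedSpace ℝ E]
    {f : ℝ → E} {f' : E} {t : ℝ} (hf : HasDerivAt f f' t)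
    (hd : DifferentiableAt ℝ (fun s => ‖f s‖) t) : deriv (fun s => ‖f s‖) t ≤ ‖f'‖ := by
  refine le_of_tendsto_of_tendsto hd.hasDerivAt.tendsto_slope hf.tendsto_slope.norm
    (.of_forall fun s => ?_)
  simp only [slope_def_field, slope_def_module, norm_smul, norm_inv, ← div_eq_inv_mul]
  exact (le_abs_self _).trans (by
    rw [abs_div, Real.norm_eq_abs]
    gcongr
    exact abs_norm_sub_norm_le _ _)

variable {f : ℝ → ℝ} {a b k C : ℝ}

theorem ae_hasDerivAt_of_absolutelyContinuousOnInterval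
    (hf : AbsolutelyContinuousOnInterval f a b) (hab : a ≤ b) :
    ∀ᵐ t, t ∈ Ioo a b → HasDerivAt f (deriv f t) t := by
  have hdiff := hf.ae_differentiableAt
  rw [uIcc_of_le hab] at hdiff
  filter_upwards [hdiff] with t ht hmem
  exact (ht (Ioo_subset_Icc_self hmem)).hasDerivAt

theorem le_of_ae_deriv_nonpos (hf : AbsolutelyContinuousOnInterval f a b) (hab : a ≤ b)
    (h : ∀ᵐ t, t ∈ Ioo a b → deriv f t ≤ 0) : f b ≤ f a := by
  have hint : ∫ t in a..b, deriv f t ≤ 0 := by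
    rw [intervalIntegral.integral_of_le hab, integral_Ioc_eq_integral_Ioo]
    exact integral_nonpos_of_ae ((ae_restrict_iff' measurableSet_Ioo).2 h)
  rw [hf.integral_deriv_eq_sub] at hint
  linarith

theorem le_add_mul_of_ae_deriv_le (hf : AbsolutelyContinuousOnInterval f a b) (hab : a ≤ b)
    (h : ∀ᵐ t, t ∈ Ioo a b → deriv f t ≤ C) : f b ≤ f a + C * (b - a) := by
  have hlin : AbsolutelyContinuousOnInterval (fun t => C * t) a b :=
    ContDiffOn.absolutelyContinuousOnInterval (by fun_prop)
  have hdecr := le_of_ae_deriv_nonpos (hf.sub hlin) hab <| by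
    filter_upwards [h, ae_hasDerivAt_of_absolutelyContinuousOnInterval hf hab]
      with t ht hderiv hmem
    have hd := (hderiv hmem).sub (hasDerivAt_const_mul C)
    exact hd.deriv.trans_le (sub_nonpos.2 (ht hmem))
  simp only [Pi.sub_apply] at hdecr
  linarith

theorem le_of_ae_deriv_nonneg (hf : AbsolutelyContinuousOnInterval f a b) (hab : a ≤ b)
    (h : ∀ᵐ t, t ∈ Ioo a b → 0 ≤ deriv f t) : f a ≤ f b := by
  have hneg : (-f) b ≤ (-f) a := le_of_ae_deriv_nonpos hf.neg hab <| by
    filter_upwards [h] with t ht hmem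
    rw [deriv.neg]
    exact neg_nonpos.2 (ht hmem)
  exact neg_le_neg_iff.1 hneg

theorem le_exp_mul_of_ae_deriv_le (hf : AbsolutelyContinuousOnInterval f a b) (hab : a ≤ b)
    (h : ∀ᵐ t, t ∈ Ioo a b → deriv f t ≤ k * f t) : f b ≤ Real.exp (k * (b - a)) * f a := by
  have hexp : AbsolutelyContinuousOnInterval (fun t => Real.exp (-k * t)) a b :=
    ContDiffOn.absolutelyContinuousOnInterval (by fun_prop)
  have hdecr := le_of_ae_deriv_nonpos (hexp.mul hf) hab <| by
    filter_upwards [h, ae_hasDerivAt_of_absolutelyContinuousOnInterval hf hab]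
      with t ht hderiv hmem
    have hd := (hasDerivAt_const_mul (-k)).exp.mul (hderiv hmem)
    refine hd.deriv.trans_le ?_
    have := mul_nonpos_of_nonneg_of_nonpos (Real.exp_pos (-k * t)).le (sub_nonpos.2 (ht hmem))
    linarith
  calc f b = Real.exp (k * b) * (Real.exp (-k * b) * f b) := by
        rw [← mul_assoc, ← Real.exp_add]; simp
    _ ≤ Real.exp (k * b) * (Real.exp (-k * a) * f a) :=
        mul_le_mul_of_nonneg_left hdecr (Real.exp_pos _).le
    _ = Real.exp (k * (b - a)) * f a := by rw [← mul_assoc, ← Real.exp_add]; ring_nf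

theorem le_max_of_ae_deriv_le (hf : AbsolutelyContinuousOnInterval f a b) (hab : a ≤ b)
    (hk : 0 < k) (h : ∀ᵐ t, t ∈ Ioo a b → deriv f t ≤ -k * f t + C) :
    f b ≤ max (f a) (C / k) := by
  have hsub : AbsolutelyContinuousOnInterval (fun t => f t - C / k) a b :=
    absolutelyContinuousOnInterval_comp_of_locallyLipschitz (g := fun x => x - C / k) hf
      (ContDiff.locallyLipschitz (𝕂 := ℝ) (by fun_prop))
  have hle := le_exp_mul_of_ae_deriv_le (k := -k) hsub hab <| by
    filter_upwards [h] with t ht hmem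
    rw [deriv_sub_const, mul_sub, neg_mul, neg_mul, mul_div_cancel₀ _ hk.ne']
    linarith [ht hmem]
  have hexp : Real.exp (-k * (b - a)) ≤ 1 := Real.exp_le_one_iff.2 (by nlinarith)
  rcases le_total (f a) (C / k) with hfa | hfa
  · exact le_max_of_le_right (by nlinarith [Real.exp_pos (-k * (b - a))])
  · exact le_max_of_le_left (by nlinarith [Real.exp_pos (-k * (b - a))])

theorem abs_le_max_of_ae_hasDerivAt {s : ℝ → ℝ} (hf : AbsolutelyContinuousOnInterval f a b)
    (hab : a ≤ b) (hk : 0 < k) (h : ∀ᵐ t, t ∈ Ioo a b → HasDerivAt f (-k * f t + s t) t)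
    (hs : ∀ t ∈ Ioo a b, |s t| ≤ C) : |f b| ≤ max |f a| (C / k) := by
  refine abs_le'.2 ⟨?_, ?_⟩
  · refine (le_max_of_ae_deriv_le hf hab hk (C := C) ?_).trans
      (max_le_max_right _ (le_abs_self _))
    filter_upwards [h] with t ht hmem
    rw [(ht hmem).deriv]
    linarith [le_of_abs_le (hs t hmem)]
  · refine (le_max_of_ae_deriv_le hf.neg hab hk (C := C) ?_).trans
      (max_le_max_right _ (neg_le_abs _))
    filter_upwards [h] with t ht hmem
    rw [(ht hmem).neg.deriv, Pi.neg_apply]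
    linarith [neg_le_of_abs_le (hs t hmem)]

end AbsolutelyContinuous

/-! ### Differential equations with a measurable additive forcing -/

theorem isPicardLindelof_comp_add {E : Type*} [NormedAddCommGroup E] [ProperSpace E] {F : E → E}
    (hF : LocallyLipschitz F) {L : ℝ≥0} (hL : ∀ x, ‖F x‖ ≤ L) {T : ℝ} (hT : 0 ≤ T) {V : ℝ → E}
    (hV : ContinuousOn V (Icc 0 T)) (w₀ : E) :
    ∃ K, IsPicardLindelof (fun t w => F (w + V t)) (tmin := 0) (tmax := T) ⟨0, le_rfl, hT⟩ w₀
      (L * T.toNNReal) 0 L K := by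
  obtain ⟨C, hC⟩ := isCompact_Icc.exists_bound_of_continuousOn hV
  have hmaps : ∀ t ∈ Icc 0 T, ∀ w ∈ Metric.closedBall w₀ (L * T.toNNReal),
      w + V t ∈ Metric.closedBall w₀ (L * T.toNNReal + C) := by
    intro t ht w hw
    rw [mem_closedBall_iff_norm] at hw ⊢
    rw [add_sub_right_comm]
    exact (norm_add_le _ _).trans (add_le_add hw (hC t ht))
  obtain ⟨K, hK⟩ := (hF.locallyLipschitzOn
    (s := Metric.closedBall w₀ (L * T.toNNReal + C))).exists_lipschitzOnWith_of_compact
      (isCompact_closedBall _ _)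
  refine ⟨K, fun t ht => LipschitzOnWith.of_dist_le_mul fun w₁ hw₁ w₂ hw₂ => ?_, fun w _ => ?_,
    fun t _ w _ => hL _, ?_⟩
  · simpa only [dist_add_right] using hK.dist_le_mul _ (hmaps t ht w₁ hw₁) _ (hmaps t ht w₂ hw₂)
  · exact hF.continuous.comp_continuousOn (continuousOn_const.add hV)
  · simp [hT]

theorem lt_of_forall_Ico_le_imp_lt {f : ℝ → ℝ} {a b M : ℝ} (hf : ContinuousOn f (Icc a b))
    (h : ∀ t ∈ Icc a b, (∀ s ∈ Ico a t, f s ≤ M) → f t < M) : ∀ t ∈ Icc a b, f t < M := by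
  by_contra! hcon
  obtain ⟨t₁, ht₁, hft₁⟩ := hcon
  have hcompact : IsCompact (Icc a b ∩ f ⁻¹' Ici M) :=
    isCompact_Icc.of_isClosed_subset (hf.preimage_isClosed_of_isClosed isClosed_Icc isClosed_Ici)
      inter_subset_left
  obtain ⟨t, ⟨ht, hft⟩, hmin⟩ := hcompact.exists_isLeast ⟨t₁, ht₁, hft₁⟩
  refine (h t ht fun s hs => ?_).not_ge hft
  by_contra! hlt
  exact hs.2.not_ge (hmin ⟨⟨hs.1, hs.2.le.trans ht.2⟩, hlt.le⟩)

section ForcedSolution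

variable {E : Type*} [NormedAddCommGroup E] [NormedSpace ℝ E]

/-- `y` is a Carathéodory solution of `y' = F y + u` on `[0, T]`: absolutely continuous, with the
equation holding at almost every time. Keeping the merely measurable forcing `u` apart from the
autonomous part `F` makes the change of unknown `y - ∫ u` reduce existence to the classical
Picard–Lindelöf theorem. -/
structure IsForcedSolutionOn (F : E → E) (u : ℝ → E) (T : ℝ) (y : ℝ → E) : Prop where
  absCont : AbsolutelyContinuousOnInterval y 0 T
  ode : ∀ᵐ t, t ∈ Ioo 0 T → HasDerivAt y (F (y t) + u t) t

namespace IsForcedSolutionOn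

variable {F G : E → E} {u : ℝ → E} {T τ : ℝ} {y y₁ y₂ : ℝ → E}

theorem mono (h : IsForcedSolutionOn F u T y) (hτ : 0 ≤ τ) (hτT : τ ≤ T) :
    IsForcedSolutionOn F u τ y where
  absCont := h.absCont.mono (by
    rw [uIcc_of_le hτ, uIcc_of_le (hτ.trans hτT)]; exact Icc_subset_Icc_right hτT)
  ode := h.ode.mono fun _ ht hmem => ht (Ioo_subset_Ioo_right hτT hmem)

theorem continuousOn (h : IsForcedSolutionOn F u T y) (hT : 0 ≤ T) : ContinuousOn y (Icc 0 T) :=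
  uIcc_of_le hT ▸ AbsolutelyContinuousOnInterval.continuousOn h.absCont

theorem absolutelyContinuous_comp {X : Type*} [PseudoMetricSpace X] {g : E → X}
    (h : IsForcedSolutionOn F u T y) (hg : LocallyLipschitz g) :
    AbsolutelyContinuousOnInterval (fun t => g (y t)) 0 T :=
  absolutelyContinuousOnInterval_comp_of_locallyLipschitz h.absCont hg

theorem congr_field (h : IsForcedSolutionOn F u T y) (hFG : ∀ t ∈ Ioo 0 T, F (y t) = G (y t)) :
    IsForcedSolutionOn G u T y where
  absCont := h.absCont
  ode := h.ode.mono fun t ht hmem => hFG t hmem ▸ ht hmem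

theorem congr (h : IsForcedSolutionOn F u T y₁) (hT : 0 ≤ T) (heq : EqOn y₁ y₂ (Icc 0 T)) :
    IsForcedSolutionOn F u T y₂ where
  absCont := absolutelyContinuousOnInterval_congr h.absCont (by rwa [uIcc_of_le hT])
  ode := h.ode.mono fun t ht hmem => by
    rw [← heq (Ioo_subset_Icc_self hmem)]
    exact (ht hmem).congr_of_eventuallyEq
      (eventuallyEq_of_mem (Icc_mem_nhds hmem.1 hmem.2) heq.symm)

theorem eqOn (hF : LocallyLipschitz F) (hT : 0 ≤ T) (h₁ : IsForcedSolutionOn F u T y₁)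
    (h₂ : IsForcedSolutionOn F u T y₂) (h0 : y₁ 0 = y₂ 0) : EqOn y₁ y₂ (Icc 0 T) := by
  intro t ht
  obtain ⟨K, hK⟩ :=
    (hF.locallyLipschitzOn (s := y₁ '' Icc 0 T ∪ y₂ '' Icc 0 T)).exists_lipschitzOnWith_of_compact
      ((isCompact_Icc.image_of_continuousOn (h₁.continuousOn hT)).union
        (isCompact_Icc.image_of_continuousOn (h₂.continuousOn hT)))
  have hdist : AbsolutelyContinuousOnInterval (fun s => ‖(y₁ - y₂) s‖) 0 t :=
    absolutelyContinuousOnInterval_comp_of_locallyLipschitz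
      ((h₁.mono ht.1 ht.2).absCont.sub (h₂.mono ht.1 ht.2).absCont)
      lipschitzWith_one_norm.locallyLipschitz
  have hgrowth := le_exp_mul_of_ae_deriv_le (k := K) hdist ht.1 <| by
    filter_upwards [h₁.ode, h₂.ode, ae_hasDerivAt_of_absolutelyContinuousOnInterval hdist ht.1]
      with s hs₁ hs₂ hnorm hmem
    have hs : s ∈ Ioo 0 T := Ioo_subset_Ioo_right ht.2 hmem
    have hderiv : HasDerivAt (y₁ - y₂) (F (y₁ s) - F (y₂ s)) s := by
      simpa only [add_sub_add_right_eq_sub] using (hs₁ hs).sub (hs₂ hs)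
    exact (deriv_norm_le_norm_of_hasDerivAt hderiv (hnorm hmem).differentiableAt).trans
      (hK.norm_sub_le (.inl ⟨s, Ioo_subset_Icc_self hs, rfl⟩)
        (.inr ⟨s, Ioo_subset_Icc_self hs, rfl⟩))
  simp only [Pi.sub_apply, h0, sub_self, norm_zero, mul_zero] at hgrowth
  exact sub_eq_zero.1 (norm_le_zero_iff.1 hgrowth)

end IsForcedSolutionOn

theorem exists_bounded_locallyLipschitz_eqOn_closedBall [FiniteDimensional ℝ E] {F : E → E}
    (hF : LocallyLipschitz F) {R : ℝ} (hR : 0 < R) :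
    ∃ G : E → E, LocallyLipschitz G ∧ EqOn G F (Metric.closedBall 0 R) ∧
      ∃ L : ℝ≥0, ∀ x, ‖G x‖ ≤ L := by
  let χ : ContDiffBump (0 : E) := ⟨R, R + 1, hR, by linarith⟩
  have hχ : LocallyLipschitz (χ : E → ℝ) :=
    ContDiff.locallyLipschitz (𝕂 := ℝ) (χ.contDiff (n := 1))
  have hsmul : LocallyLipschitz (fun p : ℝ × E => p.1 • p.2) :=
    ContDiff.locallyLipschitz (𝕂 := ℝ) (by fun_prop)
  have hG : LocallyLipschitz (fun x => χ x • F x) := hsmul.comp (hχ.prodMk hF)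
  have hsupp : HasCompactSupport (fun x => χ x • F x) := χ.hasCompactSupport.smul_right
  obtain ⟨C, hC⟩ := hsupp.exists_bound_of_continuous hG.continuous
  refine ⟨_, hG, fun x hx => ?_, C.toNNReal, fun x => (hC x).trans (Real.le_coe_toNNReal C)⟩
  simp only [χ.one_of_mem_closedBall hx, one_smul]

variable [FiniteDimensional ℝ E] {F : E → E} {u V : ℝ → E}

theorem exists_isForcedSolutionOn_of_bounded (hF : LocallyLipschitz F) {L : ℝ≥0}
    (hL : ∀ x, ‖F x‖ ≤ L) {T : ℝ} (hT : 0 ≤ T) (hV : AbsolutelyContinuousOnInterval V 0 T)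
    (hVu : ∀ᵐ t, t ∈ Ioo 0 T → HasDerivAt V (u t) t) (y₀ : E) :
    ∃ y, IsForcedSolutionOn F u T y ∧ y 0 = y₀ := by
  have : ProperSpace E := FiniteDimensional.proper ℝ E
  obtain ⟨K, hK⟩ := isPicardLindelof_comp_add hF hL hT
    (uIcc_of_le hT ▸ AbsolutelyContinuousOnInterval.continuousOn hV) (y₀ - V 0)
  obtain ⟨w, hw0, hw⟩ := hK.exists_eq_forall_mem_Icc_hasDerivWithinAt₀
  have hwAC : AbsolutelyContinuousOnInterval w 0 T := by
    refine LipschitzOnWith.absolutelyContinuousOnInterval (K := L) ?_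
    rw [uIcc_of_le hT]
    exact (convex_Icc 0 T).lipschitzOnWith_of_nnnorm_hasDerivWithin_le hw fun _ _ => hL _
  have hw0' : w 0 = y₀ - V 0 := hw0
  refine ⟨w + V, ⟨hwAC.add hV, ?_⟩, by rw [Pi.add_apply, hw0', sub_add_cancel]⟩
  filter_upwards [hVu] with t ht hmem
  exact ((hw t (Ioo_subset_Icc_self hmem)).hasDerivAt (Icc_mem_nhds hmem.1 hmem.2)).add (ht hmem)

theorem exists_isForcedSolutionOn_of_norm_le (hF : LocallyLipschitz F) {T R : ℝ} (hT : 0 ≤ T)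
    (hV : AbsolutelyContinuousOnInterval V 0 T)
    (hVu : ∀ᵐ t, t ∈ Ioo 0 T → HasDerivAt V (u t) t) (y₀ : E)
    (hR : ∀ τ, 0 ≤ τ → τ ≤ T → ∀ y, IsForcedSolutionOn F u τ y → y 0 = y₀ → ‖y τ‖ ≤ R) :
    ∃ y, IsForcedSolutionOn F u T y ∧ y 0 = y₀ := by
  set M : ℝ := max R 0 + 1
  obtain ⟨G, hG, hGF, L, hL⟩ :=
    exists_bounded_locallyLipschitz_eqOn_closedBall hF (show 0 < M by positivity)
  obtain ⟨y, hy, hy0⟩ := exists_isForcedSolutionOn_of_bounded hG hL hT hV hVu y₀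
  have hsol : ∀ τ ∈ Icc 0 T, (∀ t ∈ Ico 0 τ, ‖y t‖ ≤ M) → IsForcedSolutionOn F u τ y :=
    fun τ hτ hbound => (hy.mono hτ.1 hτ.2).congr_field fun t ht =>
      hGF (mem_closedBall_zero_iff.2 (hbound t (Ioo_subset_Ico_self ht)))
  have hlt : ∀ t ∈ Icc 0 T, ‖y t‖ < M :=
    lt_of_forall_Ico_le_imp_lt (hy.continuousOn hT).norm fun τ hτ hbound =>
      (hR τ hτ.1 hτ.2 y (hsol τ hτ hbound) hy0).trans_lt
        ((le_max_left R 0).trans_lt (lt_add_one _))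
  exact ⟨y, hsol T ⟨hT, le_rfl⟩ fun t ht => (hlt t (Ico_subset_Icc_self ht)).le, hy0⟩

theorem exists_forall_isForcedSolutionOn (hF : LocallyLipschitz F)
    (hV : ∀ T, 0 ≤ T → AbsolutelyContinuousOnInterval V 0 T)
    (hVu : ∀ᵐ t, 0 < t → HasDerivAt V (u t) t) (y₀ : E)
    (hR : ∀ T, 0 ≤ T → ∃ R, ∀ τ, 0 ≤ τ → τ ≤ T → ∀ y, IsForcedSolutionOn F u τ y → y 0 = y₀ →
      ‖y τ‖ ≤ R) :
    ∃ y, (∀ T, 0 ≤ T → IsForcedSolutionOn F u T y) ∧ y 0 = y₀ := by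
  have hex : ∀ n : ℕ, ∃ y, IsForcedSolutionOn F u n y ∧ y 0 = y₀ := fun n => by
    obtain ⟨R, hR'⟩ := hR n n.cast_nonneg
    exact exists_isForcedSolutionOn_of_norm_le hF n.cast_nonneg (hV n n.cast_nonneg)
      (hVu.mono fun t ht hmem => ht hmem.1) y₀ hR'
  choose Y hY hY0 using hex
  have hYeq : ∀ m n : ℕ, m ≤ n → EqOn (Y m) (Y n) (Icc 0 m) := fun m n hmn =>
    (hY m).eqOn hF m.cast_nonneg ((hY n).mono m.cast_nonneg (Nat.cast_le.2 hmn))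
      ((hY0 m).trans (hY0 n).symm)
  refine ⟨fun t => Y ⌈t⌉₊ t, fun T hT => ?_, by simpa using hY0 0⟩
  refine ((hY ⌈T⌉₊).mono hT (Nat.le_ceil T)).congr hT fun t ht => ?_
  exact (hYeq _ _ (Nat.ceil_mono ht.2) ⟨ht.1, Nat.le_ceil t⟩).symm

end ForcedSolution

/-! ### Locally Lipschitz functions -/

section LocallyLipschitz

attribute [fun_prop] LocallyLipschitz LocallyLipschitz.const

@[fun_prop]
theorem locallyLipschitz_fun_id {X : Type*} [PseudoMetricSpace X] :
    LocallyLipschitz fun x : X => x :=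
  LocallyLipschitz.id

@[fun_prop]
theorem locallyLipschitz_fun_comp {X Y Z : Type*} [PseudoMetricSpace X] [PseudoMetricSpace Y]
    [PseudoMetricSpace Z] {f : Y → Z} {g : X → Y} (hf : LocallyLipschitz f)
    (hg : LocallyLipschitz g) : LocallyLipschitz fun x => f (g x) :=
  hf.comp hg

@[fun_prop]
theorem locallyLipschitz_fst {X Y Z : Type*} [PseudoMetricSpace X] [PseudoMetricSpace Y]
    [PseudoMetricSpace Z] {f : X → Y × Z} (hf : LocallyLipschitz f) :
    LocallyLipschitz fun x => (f x).1 :=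
  LipschitzWith.prod_fst.locallyLipschitz.comp hf

@[fun_prop]
theorem locallyLipschitz_snd {X Y Z : Type*} [PseudoMetricSpace X] [PseudoMetricSpace Y]
    [PseudoMetricSpace Z] {f : X → Y × Z} (hf : LocallyLipschitz f) :
    LocallyLipschitz fun x => (f x).2 :=
  LipschitzWith.prod_snd.locallyLipschitz.comp hf

variable {X : Type*} [PseudoMetricSpace X]

theorem locallyLipschitz_pi {ι : Type*} [Fintype ι] {Y : ι → Type*}
    [∀ i, PseudoMetricSpace (Y i)] {f : X → ∀ i, Y i} (h : ∀ i, LocallyLipschitz fun x => f x i) :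
    LocallyLipschitz f := by
  intro x
  choose K t ht hK using fun i => h i x
  refine ⟨∑ i, K i, ⋂ i, t i, Filter.iInter_mem.2 ht, fun a ha b hb => ?_⟩
  refine edist_pi_le_iff.2 fun i => ?_
  refine (hK i (mem_iInter.1 ha i) (mem_iInter.1 hb i)).trans ?_
  gcongr
  exact Finset.single_le_sum (f := K) (fun _ _ => zero_le) (Finset.mem_univ i)

theorem locallyLipschitz_euclideanSpace {ι : Type*} [Fintype ι] {f : X → EuclideanSpace ℝ ι}
    (h : ∀ i, LocallyLipschitz fun x => f x i) : LocallyLipschitz f :=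
  (PiLp.lipschitzWith_toLp 2 fun _ : ι => ℝ).locallyLipschitz.comp (locallyLipschitz_pi h)

variable {f g : X → ℝ}

@[fun_prop]
theorem locallyLipschitz_fun_add (hf : LocallyLipschitz f) (hg : LocallyLipschitz g) :
    LocallyLipschitz fun x => f x + g x :=
  hf.add hg

@[fun_prop]
theorem locallyLipschitz_fun_sub (hf : LocallyLipschitz f) (hg : LocallyLipschitz g) :
    LocallyLipschitz fun x => f x - g x :=
  hf.sub hg

@[fun_prop]
theorem locallyLipschitz_fun_neg (hf : LocallyLipschitz f) : LocallyLipschitz fun x => -f x :=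
  locallyLipschitz_neg_iff.2 hf

@[fun_prop]
theorem locallyLipschitz_fun_mul (hf : LocallyLipschitz f) (hg : LocallyLipschitz g) :
    LocallyLipschitz fun x => f x * g x :=
  (ContDiff.locallyLipschitz (𝕂 := ℝ) (f := fun p : ℝ × ℝ => p.1 * p.2) (by fun_prop)).comp
    (hf.prodMk hg)

@[fun_prop]
theorem locallyLipschitz_fun_div_const (hf : LocallyLipschitz f) (c : ℝ) :
    LocallyLipschitz fun x => f x / c := by
  simpa only [div_eq_mul_inv] using locallyLipschitz_fun_mul hf (.const c⁻¹)

@[fun_prop]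
theorem locallyLipschitz_fun_pow (hf : LocallyLipschitz f) (n : ℕ) :
    LocallyLipschitz fun x => f x ^ n :=
  (ContDiff.locallyLipschitz (𝕂 := ℝ) (f := fun p : ℝ => p ^ n) (by fun_prop)).comp hf

@[fun_prop]
theorem locallyLipschitz_exp (hf : LocallyLipschitz f) :
    LocallyLipschitz fun x => Real.exp (f x) :=
  (ContDiff.locallyLipschitz (𝕂 := ℝ) Real.contDiff_exp).comp hf

attribute [fun_prop] LocallyLipschitz.max_const LocallyLipschitz.min_const

theorem locallyLipschitz_div_of_eventually_eq_zero (hf : LocallyLipschitz f)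
    (hg : LocallyLipschitz g) (hfg : ∀ x, g x = 0 → ∀ᶠ y in 𝓝 x, f y = 0) :
    LocallyLipschitz fun x => f x / g x := by
  intro x
  by_cases hx : g x = 0
  · exact ⟨0, {y | f y = 0}, hfg x hx, fun y hy z hz => by simp_all⟩
  · obtain ⟨K, s, hs, hK⟩ := (contDiffAt_fst.div contDiffAt_snd hx :
      ContDiffAt ℝ 1 (fun p : ℝ × ℝ => p.1 / p.2) (f x, g x)).exists_lipschitzOnWith
    have hpair : LocallyLipschitz fun y => (f y, g y) := hf.prodMk hg
    obtain ⟨K', t, ht, hK'⟩ := hpair x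
    exact ⟨K * K', t ∩ (fun y => (f y, g y)) ⁻¹' s,
      inter_mem ht (hpair.continuous.continuousAt hs),
      hK.comp (hK'.mono inter_subset_left) fun y hy => hy.2⟩

end LocallyLipschitz

namespace GFM

/-! ### Regularity of the closed loop -/

theorem sat_top (y : ℝ) : sat ⊤ y = y := by
  simp [sat]

theorem sat_coe {a : ℝ} (ha : 0 < a) (y : ℝ) : sat a y = max (-a) (min y a) := by
  simp only [sat, EReal.coe_lt_coe_iff, EReal.toReal_coe, ← EReal.coe_neg]
  split_ifs <;> grind

theorem lipschitzWith_one_sat {X : EReal} (hX : 0 < X) : LipschitzWith 1 (sat X) := by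
  induction X with
  | bot => simp at hX
  | top => simpa only [funext sat_top] using! LipschitzWith.id
  | coe a =>
    rw [funext (sat_coe (EReal.coe_pos.1 hX))]
    exact (LipschitzWith.id.min_const a).const_max (-a)

theorem sat_zero {X : EReal} (hX : 0 < X) : sat X 0 = 0 := by
  have hneg : ¬ 0 < -X := by simpa using hX.le
  simp [sat, hX.not_gt, hneg]

theorem abs_sat_le {X : EReal} (hX : 0 < X) (y : ℝ) : |sat X y| ≤ |y| := by
  simpa [Real.dist_eq, sat_zero hX] using (lipschitzWith_one_sat hX).dist_le_mul y 0

theorem locallyLipschitz_coord (i : Fin 10) : LocallyLipschitz fun x : State => x i :=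
  ContDiff.locallyLipschitz (𝕂 := ℝ) (by fun_prop)

@[fun_prop]
theorem locallyLipschitz_vcd : LocallyLipschitz State.vcd := locallyLipschitz_coord 0

@[fun_prop]
theorem locallyLipschitz_vcq : LocallyLipschitz State.vcq := locallyLipschitz_coord 1

@[fun_prop]
theorem locallyLipschitz_itd : LocallyLipschitz State.itd := locallyLipschitz_coord 2

@[fun_prop]
theorem locallyLipschitz_itq : LocallyLipschitz State.itq := locallyLipschitz_coord 3

@[fun_prop]
theorem locallyLipschitz_igd : LocallyLipschitz State.igd := locallyLipschitz_coord 4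

@[fun_prop]
theorem locallyLipschitz_igq : LocallyLipschitz State.igq := locallyLipschitz_coord 5

@[fun_prop]
theorem locallyLipschitz_q₁ : LocallyLipschitz State.q₁ := locallyLipschitz_coord 6

@[fun_prop]
theorem locallyLipschitz_q₂ : LocallyLipschitz State.q₂ := locallyLipschitz_coord 7

@[fun_prop]
theorem locallyLipschitz_p₁ : LocallyLipschitz State.p₁ := locallyLipschitz_coord 8

@[fun_prop]
theorem locallyLipschitz_p₂ : LocallyLipschitz State.p₂ := locallyLipschitz_coord 9

@[fun_prop]
theorem locallyLipschitz_p : LocallyLipschitz State.p := by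
  unfold State.p
  fun_prop

@[fun_prop]
theorem locallyLipschitz_q : LocallyLipschitz State.q := by
  unfold State.q
  fun_prop

variable (Ω : Circuit) (D : Design)

@[fun_prop]
theorem locallyLipschitz_sat_Pbar : LocallyLipschitz (sat D.Pbar) :=
  (lipschitzWith_one_sat D.Pbar_pos).locallyLipschitz

@[fun_prop]
theorem locallyLipschitz_sat_Qbar : LocallyLipschitz (sat D.Qbar) :=
  (lipschitzWith_one_sat D.Qbar_pos).locallyLipschitz

@[fun_prop]
theorem locallyLipschitz_freq : LocallyLipschitz (freq D) := by
  unfold freq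
  fun_prop

@[fun_prop]
theorem locallyLipschitz_vcdRef : LocallyLipschitz (vcdRef D) := by
  unfold vcdRef
  fun_prop

@[fun_prop]
theorem locallyLipschitz_itdRef : LocallyLipschitz (itdRef Ω D) := by
  unfold itdRef
  fun_prop

@[fun_prop]
theorem locallyLipschitz_itqRef : LocallyLipschitz (itqRef Ω D) := by
  unfold itqRef
  fun_prop

@[fun_prop]
theorem locallyLipschitz_Wd : LocallyLipschitz (Wd Ω D) := by
  unfold Wd
  fun_prop

@[fun_prop]
theorem locallyLipschitz_Wq : LocallyLipschitz (Wq Ω D) := by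
  unfold Wq
  fun_prop

@[fun_prop]
theorem locallyLipschitz_vtdNom :
    LocallyLipschitz fun y : FullState => vtdNom Ω D y.1 y.2.1 := by
  unfold vtdNom ud
  fun_prop

@[fun_prop]
theorem locallyLipschitz_vtqNom :
    LocallyLipschitz fun y : FullState => vtqNom Ω D y.1 y.2.2 := by
  unfold vtqNom uq
  fun_prop

theorem it_dotProduct_it (x : State) : x.it ⬝ᵥ x.it = x.itd ^ 2 + x.itq ^ 2 := by
  simp [State.it, sq]

theorem eta_eq (x : State) (v : Fin 2 → ℝ) :
    eta Ω D x v = 2 * (Ω.Rf / Ω.Lf * Ω.ωb) * (x.itd ^ 2 + x.itq ^ 2)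
      + 2 * Ω.ωb / Ω.Lf * (x.itd * x.vcd + x.itq * x.vcq)
      - 2 * Ω.ωb / Ω.Lf * (x.itd * v 0 + x.itq * v 1)
      + D.c * (D.Imax ^ 2 - (x.itd ^ 2 + x.itq ^ 2)) := by
  rw [eta, barrier, it_dotProduct_it]
  simp only [State.it, State.vc, A, Matrix.mulVec, dotProduct, Fin.sum_univ_two, Matrix.of_apply,
    Matrix.cons_val_zero, Matrix.cons_val_one]
  ring

/-- The slack `η` of the barrier condition under the nominal control, as a function of the
closed-loop state; the safety filter is active where it is negative. -/
noncomputable def slack (y : FullState) : ℝ := eta Ω D y.1 (vtNom Ω D y)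

/-- The factor `min(η, 0) / ‖i_t‖²` of the safety filter's correction, which makes the filter a
single formula. There is no singularity: `η > 0` near `i_t = 0`, so the numerator vanishes there. -/
noncomputable def correction (y : FullState) : ℝ :=
  min (slack Ω D y) 0 / (y.1.itd ^ 2 + y.1.itq ^ 2)

@[fun_prop]
theorem locallyLipschitz_slack : LocallyLipschitz (slack Ω D) := by
  unfold slack
  simp only [eta_eq, vtNom, Matrix.cons_val_zero, Matrix.cons_val_one]
  fun_prop

variable {D} in
theorem slack_pos_of_current_eq_zero {y : FullState} (h : y.1.itd ^ 2 + y.1.itq ^ 2 = 0) :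
    0 < slack Ω D y := by
  have hd : y.1.itd = 0 := by nlinarith [sq_nonneg y.1.itd, sq_nonneg y.1.itq]
  have hq : y.1.itq = 0 := by nlinarith [sq_nonneg y.1.itd, sq_nonneg y.1.itq]
  have hpos : 0 < D.c * D.Imax ^ 2 := mul_pos D.c_pos (pow_pos D.Imax_pos 2)
  simpa [slack, eta_eq, hd, hq] using hpos

@[fun_prop]
theorem locallyLipschitz_correction : LocallyLipschitz (correction Ω D) := by
  unfold correction
  refine locallyLipschitz_div_of_eventually_eq_zero (by fun_prop) (by fun_prop) fun y hy => ?_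
  filter_upwards [(locallyLipschitz_slack Ω D).continuous.continuousAt.eventually_const_lt
    (slack_pos_of_current_eq_zero Ω hy)] with z hz using min_eq_right hz.le

theorem safetyFilter_eq (y : FullState) :
    safetyFilter Ω D y.1 (vtNom Ω D y) =
      vtNom Ω D y + (Ω.Lf / (2 * Ω.ωb) * correction Ω D y) • y.1.it := by
  rw [safetyFilter, correction, it_dotProduct_it, slack]
  split_ifs with h
  · simp [min_eq_right h]
  · rw [min_eq_left (not_le.1 h).le]

theorem locallyLipschitz_safetyFilter (i : Fin 2) :
    LocallyLipschitz fun y : FullState => safetyFilter Ω D y.1 (vtNom Ω D y) i := by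
  simp only [safetyFilter_eq]
  fin_cases i <;>
    simp only [vtNom, State.it, Fin.zero_eta, Fin.mk_one, Pi.add_apply, Pi.smul_apply,
      smul_eq_mul, Matrix.cons_val_zero, Matrix.cons_val_one] <;>
    fun_prop

theorem locallyLipschitz_plantField (vgd vgq : ℝ) {vt : FullState → Fin 2 → ℝ}
    (hvt : ∀ i, LocallyLipschitz fun y => vt y i) :
    LocallyLipschitz fun y : FullState => plantField Ω D vgd vgq (vt y) y.1 := by
  have := hvt 0
  have := hvt 1
  unfold plantField
  refine locallyLipschitz_euclideanSpace fun i => ?_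
  fin_cases i <;>
    simp only [Fin.reduceFinMk, Fin.zero_eta, Fin.mk_one, Matrix.cons_val] <;>
    fun_prop (disch := assumption)

theorem locallyLipschitz_closedLoopField (vgd vgq : ℝ) :
    LocallyLipschitz (closedLoopField Ω D vgd vgq) :=
  (locallyLipschitz_plantField Ω D vgd vgq (locallyLipschitz_safetyFilter Ω D)).prodMk
    (.prodMk (by fun_prop) (by fun_prop))

end GFM

/-! ### The grid voltage as an additive forcing -/

namespace GFM

namespace IsBoundedSignal

variable {v : ℝ → ℝ}

theorem intervalIntegrable (hv : IsBoundedSignal v) {T : ℝ} (hT : 0 ≤ T) :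
    IntervalIntegrable v volume 0 T := by
  rw [intervalIntegrable_iff_integrableOn_Ioc_of_le hT]
  exact (hv.mono_measure
    (Measure.restrict_mono (fun t ht => ht.1.le) le_rfl)).integrable le_top

theorem ae_abs_le (hv : IsBoundedSignal v) : ∀ᵐ t, 0 < t → |v t| ≤ supNorm v := by
  have h := ae_le_eLpNormEssSup (f := v) (μ := volume.restrict (Ici (0 : ℝ)))
  rw [ae_restrict_iff' measurableSet_Ici] at h
  filter_upwards [h] with t ht h0
  rw [← eLpNorm_exponent_top] at ht
  have hle : ‖v t‖₊ ≤ supNorm v := ENNReal.toNNReal_mono hv.2.ne (ht h0.le)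
  exact_mod_cast hle

theorem ae_hasDerivAt_primitive (hv : IsBoundedSignal v) :
    ∀ᵐ t, 0 < t → HasDerivAt (fun s => ∫ r in (0 : ℝ)..s, v r) (v t) t := by
  have h : ∀ n : ℕ, ∀ᵐ t, t ∈ uIcc (0 : ℝ) n →
      HasDerivAt (fun s => ∫ r in (0 : ℝ)..s, v r) (v t) t := fun n => by
    filter_upwards [(hv.intervalIntegrable n.cast_nonneg).ae_hasDerivAt_integral]
      with t ht hmem using ht hmem 0 left_mem_uIcc
  filter_upwards [ae_all_iff.2 h] with t ht h0
  exact ht ⌈t⌉₊ (uIcc_of_le (α := ℝ) (Nat.cast_nonneg _) ▸ ⟨h0.le, Nat.le_ceil t⟩)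

end IsBoundedSignal

section GridForcing

variable (Ω : Circuit) {D : Design} {vgd vgq : ℝ → ℝ}

/-- The contribution of the grid voltage `(a, b)` to the closed-loop field; it is additive, so that
the closed loop is an autonomous system with an additive forcing. -/
noncomputable def gridForcing (a b : ℝ) : FullState :=
  a • (EuclideanSpace.single 4 (-(Ω.ωb / Ω.L)), 0, 0) +
    b • (EuclideanSpace.single 5 (-(Ω.ωb / Ω.L)), 0, 0)

theorem closedLoopField_eq (a b : ℝ) (y : FullState) :
    closedLoopField Ω D a b y = closedLoopField Ω D 0 0 y + gridForcing Ω a b := by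
  refine Prod.ext ?_ (by simp [closedLoopField, gridForcing])
  ext i
  fin_cases i <;> simp [closedLoopField, plantField, gridForcing] <;> ring

/-- The primitive of the forcing by the grid voltage: closed-loop solutions are built as this
function plus the solution of a differential equation with continuous right-hand side. -/
noncomputable def gridPrimitive (vgd vgq : ℝ → ℝ) (t : ℝ) : FullState :=
  gridForcing Ω (∫ r in (0 : ℝ)..t, vgd r) (∫ r in (0 : ℝ)..t, vgq r)

theorem absolutelyContinuous_gridPrimitive (hd : IsBoundedSignal vgd) (hq : IsBoundedSignal vgq)
    {T : ℝ} (hT : 0 ≤ T) : AbsolutelyContinuousOnInterval (gridPrimitive Ω vgd vgq) 0 T := by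
  have hsmul (g : FullState) {v : ℝ → ℝ} (hv : IsBoundedSignal v) :
      AbsolutelyContinuousOnInterval (fun t => (∫ r in (0 : ℝ)..t, v r) • g) 0 T :=
    absolutelyContinuousOnInterval_comp_of_locallyLipschitz (g := fun c : ℝ => c • g)
      ((hv.intervalIntegrable hT).absolutelyContinuousOnInterval_intervalIntegral left_mem_uIcc)
      (ContDiff.locallyLipschitz (𝕂 := ℝ) (by fun_prop))
  exact (hsmul _ hd).fun_add (hsmul _ hq)

theorem ae_hasDerivAt_gridPrimitive (hd : IsBoundedSignal vgd) (hq : IsBoundedSignal vgq) :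
    ∀ᵐ t, 0 < t → HasDerivAt (gridPrimitive Ω vgd vgq) (gridForcing Ω (vgd t) (vgq t)) t := by
  filter_upwards [hd.ae_hasDerivAt_primitive, hq.ae_hasDerivAt_primitive] with t htd htq h0
  exact ((htd h0).smul_const _).add ((htq h0).smul_const _)

end GridForcing

/-- `y` is an absolutely continuous solution of the closed loop on `[0, T]`. -/
abbrev IsSolutionUpTo (Ω : Circuit) (D : Design) (vgd vgq : ℝ → ℝ) (T : ℝ)
    (y : ℝ → FullState) : Prop :=
  IsForcedSolutionOn (closedLoopField Ω D 0 0) (fun t => gridForcing Ω (vgd t) (vgq t)) T y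

variable {Ω : Circuit} {D : Design} {vgd vgq : ℝ → ℝ} {T : ℝ} {y : ℝ → FullState}

theorem isSolution_iff_forall_isSolutionUpTo :
    IsSolution Ω D vgd vgq y ↔ ∀ T, 0 ≤ T → IsSolutionUpTo Ω D vgd vgq T y := by
  constructor
  · refine fun h T hT => ⟨h.absCont T hT, ?_⟩
    filter_upwards [(ae_restrict_iff' measurableSet_Ici).1 h.ode] with t ht hmem
    exact closedLoopField_eq Ω (vgd t) (vgq t) (y t) ▸ ht hmem.1.le
  · refine fun h => ⟨fun T hT => (h T hT).absCont, ?_⟩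
    rw [Measure.restrict_congr_set Ioi_ae_eq_Ici.symm, ae_restrict_iff' measurableSet_Ioi]
    filter_upwards [ae_all_iff.2 fun n : ℕ => (h n n.cast_nonneg).ode] with t ht h0
    obtain ⟨n, hn⟩ := exists_nat_gt t
    exact closedLoopField_eq Ω (vgd t) (vgq t) (y t) ▸ ht n ⟨h0, hn⟩

/-! ### Derivatives of the physical states -/

section PlantDerivatives

variable {a b t : ℝ} {vt : Fin 2 → ℝ} {x : ℝ → State}

theorem hasDerivAt_coord {x' : State} (h : HasDerivAt x x' t) (i : Fin 10) :
    HasDerivAt (fun s => x s i) (x' i) t :=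
  (EuclideanSpace.proj i : State →L[ℝ] ℝ).hasFDerivAt.comp_hasDerivAt t h

variable (h : HasDerivAt x (plantField Ω D a b vt (x t)) t)

include h

theorem hasDerivAt_vcd : HasDerivAt (fun s => (x s).vcd)
    (Ω.ωb * freq D (x t) * (x t).vcq + Ω.ωb / Ω.Cf * ((x t).itd - (x t).igd)) t :=
  hasDerivAt_coord h 0

theorem hasDerivAt_vcq : HasDerivAt (fun s => (x s).vcq)
    (-Ω.ωb * freq D (x t) * (x t).vcd + Ω.ωb / Ω.Cf * ((x t).itq - (x t).igq)) t :=
  hasDerivAt_coord h 1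

theorem hasDerivAt_itd : HasDerivAt (fun s => (x s).itd)
    (Ω.ωb * freq D (x t) * (x t).itq + Ω.ωb / Ω.Lf * (vt 0 - (x t).vcd)
      - Ω.ωb * Ω.Rf / Ω.Lf * (x t).itd) t :=
  hasDerivAt_coord h 2

theorem hasDerivAt_itq : HasDerivAt (fun s => (x s).itq)
    (-Ω.ωb * freq D (x t) * (x t).itd + Ω.ωb / Ω.Lf * (vt 1 - (x t).vcq)
      - Ω.ωb * Ω.Rf / Ω.Lf * (x t).itq) t :=
  hasDerivAt_coord h 3

theorem hasDerivAt_igd : HasDerivAt (fun s => (x s).igd)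
    (Ω.ωb * freq D (x t) * (x t).igq + Ω.ωb / Ω.L * ((x t).vcd - a)
      - Ω.ωb * Ω.R / Ω.L * (x t).igd) t :=
  hasDerivAt_coord h 4

theorem hasDerivAt_igq : HasDerivAt (fun s => (x s).igq)
    (-Ω.ωb * freq D (x t) * (x t).igd + Ω.ωb / Ω.L * ((x t).vcq - b)
      - Ω.ωb * Ω.R / Ω.L * (x t).igq) t :=
  hasDerivAt_coord h 5

theorem hasDerivAt_q₁ : HasDerivAt (fun s => (x s).q₁) (x t).q₂ t :=
  hasDerivAt_coord h 6

theorem hasDerivAt_q₂ : HasDerivAt (fun s => (x s).q₂)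
    (-2 * D.ξq * D.ωqc * (x t).q₂ - D.ωqc ^ 2 * ((x t).q₁ - sat D.Qbar (x t).q)) t :=
  hasDerivAt_coord h 7

theorem hasDerivAt_p₁ : HasDerivAt (fun s => (x s).p₁) (x t).p₂ t :=
  hasDerivAt_coord h 8

theorem hasDerivAt_p₂ : HasDerivAt (fun s => (x s).p₂)
    (-2 * D.ξp * D.ωpc * (x t).p₂ - D.ωpc ^ 2 * ((x t).p₁ - sat D.Pbar (x t).p)) t :=
  hasDerivAt_coord h 9

end PlantDerivatives

theorem ae_hasDerivAt_fst (hy : IsSolutionUpTo Ω D vgd vgq T y) :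
    ∀ᵐ t, t ∈ Ioo 0 T → HasDerivAt (fun s => (y s).1)
      (plantField Ω D (vgd t) (vgq t) (safetyFilter Ω D (y t).1 (vtNom Ω D (y t))) (y t).1) t := by
  filter_upwards [hy.ode] with t ht hmem
  have h := ht hmem
  rw [← closedLoopField_eq] at h
  exact (hasFDerivAt_fst (𝕜 := ℝ)).comp_hasDerivAt t h

/-! ### Safety -/

theorem correction_mul_current_sq (y : FullState) :
    correction Ω D y * (y.1.itd ^ 2 + y.1.itq ^ 2) = min (slack Ω D y) 0 := by
  by_cases h : y.1.itd ^ 2 + y.1.itq ^ 2 = 0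
  · rw [h, mul_zero, min_eq_right (slack_pos_of_current_eq_zero Ω h).le]
  · rw [correction, div_mul_cancel₀ _ h]

theorem hasDerivAt_current_sq {a b t : ℝ} (h : HasDerivAt (fun s => (y s).1)
      (plantField Ω D a b (safetyFilter Ω D (y t).1 (vtNom Ω D (y t))) (y t).1) t) :
    HasDerivAt (fun s => (y s).1.itd ^ 2 + (y s).1.itq ^ 2)
      (D.c * (D.Imax ^ 2 - ((y t).1.itd ^ 2 + (y t).1.itq ^ 2)) - max (slack Ω D (y t)) 0) t := by
  have hΩ := Ω.ωb_pos.ne'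
  have hL := Ω.Lf_pos.ne'
  have hcorr := correction_mul_current_sq (Ω := Ω) (D := D) (y t)
  have hmax := min_add_max (slack Ω D (y t)) 0
  have hslack : slack Ω D (y t) = _ := eta_eq Ω D (y t).1 (vtNom Ω D (y t))
  refine (((hasDerivAt_itd h).pow 2).add ((hasDerivAt_itq h).pow 2)).congr_deriv ?_
  rw [eq_sub_of_add_eq' hmax, ← hcorr, hslack]
  simp only [safetyFilter_eq, Pi.add_apply, Pi.smul_apply, smul_eq_mul, State.it,
    Matrix.cons_val_zero, Matrix.cons_val_one]
  field_simp
  ring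

theorem current_sq_le (hT : 0 ≤ T) (hy : IsSolutionUpTo Ω D vgd vgq T y)
    (h0 : (y 0).1 ∈ safeSet D) : (y T).1.itd ^ 2 + (y T).1.itq ^ 2 ≤ D.Imax ^ 2 := by
  have hac := hy.absolutelyContinuous_comp
    (g := fun z : FullState => z.1.itd ^ 2 + z.1.itq ^ 2) (by fun_prop)
  refine (le_max_of_ae_deriv_le hac hT D.c_pos (C := D.c * D.Imax ^ 2) ?_).trans
    (max_le h0 (mul_div_cancel_left₀ _ D.c_pos.ne').le)
  filter_upwards [ae_hasDerivAt_fst hy] with t ht hmem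
  rw [(hasDerivAt_current_sq (ht hmem)).deriv]
  linarith [le_max_right (slack Ω D (y t)) 0]

end GFM

/-! ### The grid-side energy -/

namespace GFM

section Storage

/-- The energy of a capacitor `a` with voltage `v` and an inductor `l` with current `i`, perturbed
by a cross term that makes it decay strictly although only the inductor has a series resistance. -/
noncomputable def storage (a l δ v i : ℝ) : ℝ := (a * v ^ 2 + l * i ^ 2) / 2 - δ * (v * i)

/-- The derivative of `storage` for `a v' = τ - i` and `l i' = v - g - r i`. -/
noncomputable def storageRate (a l r δ v i τ g : ℝ) : ℝ :=
  v * (τ - i) + i * (v - g - r * i) - δ * ((τ - i) / a * i + v * ((v - g - r * i) / l))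

variable {a l r δ : ℝ}

theorem abs_cross_term_le (hδ : 0 ≤ δ) (hδa : δ ≤ a / 2) (hδl : δ ≤ l / 2) (v i : ℝ) :
    |δ * (v * i)| ≤ (a * v ^ 2 + l * i ^ 2) / 4 := by
  have habs : |v * i| ≤ (v ^ 2 + i ^ 2) / 2 :=
    abs_le.2 ⟨by linarith [sq_nonneg (v + i)], by linarith [sq_nonneg (v - i)]⟩
  calc |δ * (v * i)| = δ * |v * i| := by rw [abs_mul, abs_of_nonneg hδ]
    _ ≤ δ * ((v ^ 2 + i ^ 2) / 2) := by gcongr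
    _ = (δ * v ^ 2 + δ * i ^ 2) / 2 := by ring
    _ ≤ (a / 2 * v ^ 2 + l / 2 * i ^ 2) / 2 := by gcongr
    _ = _ := by ring

theorem mul_sq_add_sq_le_storage (hδ : 0 ≤ δ) (hδa : δ ≤ a / 2) (hδl : δ ≤ l / 2) (v i : ℝ) :
    min a l / 4 * (v ^ 2 + i ^ 2) ≤ storage a l δ v i := by
  have hmin : min a l * v ^ 2 + min a l * i ^ 2 ≤ a * v ^ 2 + l * i ^ 2 := by
    gcongr
    exacts [min_le_left _ _, min_le_right _ _]
  rw [storage]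
  linarith [(abs_le.1 (abs_cross_term_le hδ hδa hδl v i)).2]

theorem storage_le (hδ : 0 ≤ δ) (hδa : δ ≤ a / 2) (hδl : δ ≤ l / 2) (v i : ℝ) :
    storage a l δ v i ≤ a * v ^ 2 + l * i ^ 2 := by
  have hcross := abs_le.1 (abs_cross_term_le hδ hδa hδl v i)
  rw [storage]
  linarith

/-- Completion of squares in each of the five mixed products. -/
theorem storageRate_le (ha : 0 < a) (hl : 0 < l) (hr : 0 < r) (hδ : 0 < δ)
    (hδr : δ / a + δ * r ^ 2 / l ≤ r / 4) (v i τ g : ℝ) :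
    storageRate a l r δ v i τ g ≤ -(δ / (2 * l) * v ^ 2 + r / 2 * i ^ 2)
      + (2 * l / δ + 2 * δ ^ 2 / (r * a ^ 2)) * τ ^ 2 + (2 * δ / l + 2 / r) * g ^ 2 := by
  have hsquares : 0 ≤ δ / (8 * l) * (v - 4 * l / δ * τ) ^ 2 + δ / (8 * l) * (v - 4 * g) ^ 2
      + δ / (4 * l) * (v - 2 * r * i) ^ 2 + r / 8 * (i + 4 * g / r) ^ 2
      + r / 8 * (i + 4 * δ / (r * a) * τ) ^ 2 := by positivity
  have hi := mul_le_mul_of_nonneg_right hδr (sq_nonneg i)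
  rw [← sub_nonneg] at hi ⊢
  refine (add_nonneg hsquares hi).trans_eq ?_
  rw [storageRate]
  field_simp
  ring

theorem exists_cross_term (ha : 0 < a) (hl : 0 < l) (hr : 0 < r) :
    ∃ δ, 0 < δ ∧ δ ≤ a / 2 ∧ δ ≤ l / 2 ∧ δ / a + δ * r ^ 2 / l ≤ r / 4 := by
  have hden : 0 < 1 / a + r ^ 2 / l := by positivity
  refine ⟨min (min (a / 2) (l / 2)) (r / 4 / (1 / a + r ^ 2 / l)), by positivity,
    (min_le_left _ _).trans (min_le_left _ _), (min_le_left _ _).trans (min_le_right _ _), ?_⟩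
  calc _ = min (min (a / 2) (l / 2)) (r / 4 / (1 / a + r ^ 2 / l)) * (1 / a + r ^ 2 / l) := by
        ring
    _ ≤ r / 4 := (le_div_iff₀ hden).1 (min_le_right _ _)

theorem exists_storage_dissipative (ha : 0 < a) (hl : 0 < l) (hr : 0 < r) :
    ∃ δ κ C k : ℝ, 0 < κ ∧ 0 ≤ C ∧ 0 < k ∧ ∀ v i, k * (v ^ 2 + i ^ 2) ≤ storage a l δ v i ∧
      ∀ τ g, storageRate a l r δ v i τ g ≤ -κ * storage a l δ v i + C * (τ ^ 2 + g ^ 2) := by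
  obtain ⟨δ, hδ, hδa, hδl, hδr⟩ := exists_cross_term ha hl hr
  refine ⟨δ, min (δ / (2 * l * a)) (r / (2 * l)),
    max (2 * l / δ + 2 * δ ^ 2 / (r * a ^ 2)) (2 * δ / l + 2 / r), min a l / 4,
    by positivity, by positivity, by positivity, fun v i =>
    ⟨mul_sq_add_sq_le_storage hδ.le hδa hδl v i, fun τ g => ?_⟩⟩
  have hdecay : min (δ / (2 * l * a)) (r / (2 * l)) * storage a l δ v i ≤
      δ / (2 * l) * v ^ 2 + r / 2 * i ^ 2 := by
    calc _ ≤ min (δ / (2 * l * a)) (r / (2 * l)) * (a * v ^ 2 + l * i ^ 2) := by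
          gcongr
          exact storage_le hδ.le hδa hδl v i
      _ ≤ δ / (2 * l * a) * (a * v ^ 2) + r / (2 * l) * (l * i ^ 2) := by
          rw [mul_add]
          gcongr
          exacts [min_le_left _ _, min_le_right _ _]
      _ = _ := by field_simp
  have hsupply : (2 * l / δ + 2 * δ ^ 2 / (r * a ^ 2)) * τ ^ 2 + (2 * δ / l + 2 / r) * g ^ 2 ≤
      max (2 * l / δ + 2 * δ ^ 2 / (r * a ^ 2)) (2 * δ / l + 2 / r) * (τ ^ 2 + g ^ 2) := by
    rw [mul_add]
    gcongr
    exacts [le_max_left _ _, le_max_right _ _]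
  linarith [storageRate_le ha hl hr hδ hδr v i τ g]

end Storage

variable {Ω : Circuit} {D : Design}

/-- The total storage of the two axes; the rotation terms of the dynamics cancel in the sum. -/
noncomputable def gridEnergy (Ω : Circuit) (δ : ℝ) (x : State) : ℝ :=
  storage Ω.Cf Ω.L δ x.vcd x.igd + storage Ω.Cf Ω.L δ x.vcq x.igq

@[fun_prop]
theorem locallyLipschitz_gridEnergy (δ : ℝ) : LocallyLipschitz (gridEnergy Ω δ) := by
  unfold gridEnergy storage
  fun_prop

theorem hasDerivAt_gridEnergy {a b t : ℝ} {vt : Fin 2 → ℝ} {x : ℝ → State}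
    (h : HasDerivAt x (plantField Ω D a b vt (x t)) t) (δ : ℝ) :
    HasDerivAt (fun s => gridEnergy Ω δ (x s))
      (Ω.ωb * (storageRate Ω.Cf Ω.L Ω.R δ (x t).vcd (x t).igd (x t).itd a
        + storageRate Ω.Cf Ω.L Ω.R δ (x t).vcq (x t).igq (x t).itq b)) t := by
  have hC := Ω.Cf_pos.ne'
  have hL := Ω.L_pos.ne'
  have hvd := hasDerivAt_vcd h
  have hvq := hasDerivAt_vcq h
  have hid := hasDerivAt_igd h
  have hiq := hasDerivAt_igq h
  refine ((((((hvd.pow 2).const_mul Ω.Cf).add ((hid.pow 2).const_mul Ω.L)).div_const 2).sub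
    ((hvd.mul hid).const_mul δ)).add
    (((((hvq.pow 2).const_mul Ω.Cf).add ((hiq.pow 2).const_mul Ω.L)).div_const 2).sub
      ((hvq.mul hiq).const_mul δ))).congr_deriv ?_
  simp only [storageRate]
  field_simp
  ring

theorem exists_grid_bound (Ω : Circuit) (D : Design) :
    ∃ B : State × ℝ≥0 × ℝ≥0 → ℝ≥0, Continuous B ∧
      ∀ vgd vgq : ℝ → ℝ, IsBoundedSignal vgd → IsBoundedSignal vgq → ∀ T, 0 ≤ T → ∀ y,
        IsSolutionUpTo Ω D vgd vgq T y → (y 0).1 ∈ safeSet D →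
        (y T).1.vcd ^ 2 + (y T).1.vcq ^ 2 + (y T).1.igd ^ 2 + (y T).1.igq ^ 2
          ≤ B ((y 0).1, supNorm vgd, supNorm vgq) := by
  obtain ⟨δ, κ, C, k, hκ, hC, hk, hstorage⟩ :=
    exists_storage_dissipative Ω.Cf_pos Ω.L_pos Ω.R_pos
  have hcont : Continuous (gridEnergy Ω δ) := (locallyLipschitz_gridEnergy δ).continuous
  refine ⟨fun p => ((max (gridEnergy Ω δ p.1) (Ω.ωb * (C * (D.Imax ^ 2 + (p.2.1 : ℝ) ^ 2 +
    (p.2.2 : ℝ) ^ 2)) / (Ω.ωb * κ))) / k).toNNReal, by fun_prop, ?_⟩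
  intro vgd vgq hd hq T hT y hy h0
  refine le_trans ?_ (Real.le_coe_toNNReal _)
  calc _ ≤ gridEnergy Ω δ (y T).1 / k := by
        rw [le_div_iff₀ hk, gridEnergy]
        linarith [(hstorage (y T).1.vcd (y T).1.igd).1, (hstorage (y T).1.vcq (y T).1.igq).1]
    _ ≤ _ := by
        gcongr
        refine le_max_of_ae_deriv_le (f := fun t => gridEnergy Ω δ (y t).1)
          (hy.absolutelyContinuous_comp (g := fun z : FullState => gridEnergy Ω δ z.1)
            (by fun_prop)) hT (mul_pos Ω.ωb_pos hκ) ?_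
        filter_upwards [ae_hasDerivAt_fst hy, hd.ae_abs_le, hq.ae_abs_le] with t ht hvd hvq hmem
        have hd2 : vgd t ^ 2 ≤ (supNorm vgd : ℝ) ^ 2 :=
          sq_le_sq.2 ((hvd hmem.1).trans (le_abs_self _))
        have hq2 : vgq t ^ 2 ≤ (supNorm vgq : ℝ) ^ 2 :=
          sq_le_sq.2 ((hvq hmem.1).trans (le_abs_self _))
        have hi := current_sq_le hmem.1.le (hy.mono hmem.1.le hmem.2.le) h0
        have hsupply := mul_le_mul_of_nonneg_left (add_le_add (add_le_add hi hd2) hq2) hC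
        have hdr := (hstorage (y t).1.vcd (y t).1.igd).2 (y t).1.itd (vgd t)
        have hqr := (hstorage (y t).1.vcq (y t).1.igq).2 (y t).1.itq (vgq t)
        rw [(hasDerivAt_gridEnergy (ht hmem) δ).deriv, gridEnergy]
        refine (mul_le_mul_of_nonneg_left (add_le_add hdr hqr) Ω.ωb_pos.le).trans ?_
        linarith [mul_le_mul_of_nonneg_left hsupply Ω.ωb_pos.le]

end GFM

/-! ### The power filters -/

section OverdampedFilter

theorem exists_real_poles {ω ξ : ℝ} (hω : 0 < ω) (hξ : 1 < ξ) :
    ∃ a b, 0 < a ∧ 0 < b ∧ a + b = 2 * ξ * ω ∧ a * b = ω ^ 2 := by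
  have hdisc : 0 ≤ ξ ^ 2 - 1 := by nlinarith
  have hsq : √(ξ ^ 2 - 1) ^ 2 = ξ ^ 2 - 1 := Real.sq_sqrt hdisc
  have hlt : √(ξ ^ 2 - 1) < ξ := (Real.sqrt_lt' (by linarith)).2 (by linarith)
  refine ⟨ω * (ξ - √(ξ ^ 2 - 1)), ω * (ξ + √(ξ ^ 2 - 1)), mul_pos hω (sub_pos.2 hlt),
    by positivity, by ring, ?_⟩
  linear_combination (-ω ^ 2) * hsq

variable {a b S T : ℝ} {f₁ f₂ s : ℝ → ℝ}

/-- The filter is a cascade of two first-order filters: `f₂ + a f₁` is the output of the one with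
pole `b` and the input of the one with pole `a`. -/
theorem sq_add_sq_le_of_overdamped_filter (ha : 0 < a) (hb : 0 < b) (hT : 0 ≤ T)
    (hf₁ : AbsolutelyContinuousOnInterval f₁ 0 T) (hf₂ : AbsolutelyContinuousOnInterval f₂ 0 T)
    (h₁ : ∀ᵐ t, t ∈ Ioo 0 T → HasDerivAt f₁ (f₂ t) t)
    (h₂ : ∀ᵐ t, t ∈ Ioo 0 T → HasDerivAt f₂ (-(a + b) * f₂ t - a * b * (f₁ t - s t)) t)
    (hS : 0 ≤ S) (hs : ∀ t ∈ Ioo 0 T, |s t| ≤ S) :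
    f₁ T ^ 2 + f₂ T ^ 2 ≤ (1 / a ^ 2 + 4) * (|f₂ 0| + a * (|f₁ 0| + S)) ^ 2 := by
  obtain ⟨M, hM⟩ : ∃ M, M = |f₂ 0| + a * (|f₁ 0| + S) := ⟨_, rfl⟩
  rw [← hM]
  have hcascade : ∀ t ∈ Icc 0 T, |f₂ t + a * f₁ t| ≤ M := fun t ht => by
    have hac : AbsolutelyContinuousOnInterval (fun t => f₂ t + a * f₁ t) 0 t :=
      (hf₂.fun_add (hf₁.const_mul a)).mono (by
        rw [uIcc_of_le ht.1, uIcc_of_le hT]; exact Icc_subset_Icc_right ht.2)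
    refine (abs_le_max_of_ae_hasDerivAt hac ht.1 hb (s := fun t => a * b * s t)
      (C := a * b * S) ?_ fun r hr => ?_).trans (max_le ?_ ?_)
    · filter_upwards [h₁, h₂] with r hr₁ hr₂ hmem
      have hmem := Ioo_subset_Ioo_right ht.2 hmem
      exact ((hr₂ hmem).add ((hr₁ hmem).const_mul a)).congr_deriv (by ring)
    · rw [abs_mul, abs_of_pos (mul_pos ha hb)]
      gcongr
      exact hs r (Ioo_subset_Ioo_right ht.2 hr)
    · calc |f₂ 0 + a * f₁ 0| ≤ |f₂ 0| + |a * f₁ 0| := abs_add_le _ _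
        _ = |f₂ 0| + a * (|f₁ 0| + 0) := by rw [abs_mul, abs_of_pos ha, add_zero]
        _ ≤ M := by rw [hM]; gcongr
    · calc a * b * S / b = 0 + a * (0 + S) := by field_simp; ring
        _ ≤ M := by rw [hM]; gcongr <;> positivity
  have hf₁T : |f₁ T| ≤ M / a := by
    refine (abs_le_max_of_ae_hasDerivAt hf₁ hT ha (s := fun t => f₂ t + a * f₁ t) ?_
      fun t ht => hcascade t (Ioo_subset_Icc_self ht)).trans (max_le ?_ le_rfl)
    · filter_upwards [h₁] with t ht hmem using (ht hmem).congr_deriv (by ring)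
    · rw [le_div_iff₀' ha, hM]
      linarith [abs_nonneg (f₂ 0), mul_nonneg ha.le hS]
  have hf₂T : |f₂ T| ≤ 2 * M := by
    have hsum := hcascade T (right_mem_Icc.2 hT)
    have hmul : |a * f₁ T| ≤ M := by
      rwa [abs_mul, abs_of_pos ha, ← le_div_iff₀' ha]
    calc |f₂ T| = |f₂ T + a * f₁ T - a * f₁ T| := by rw [add_sub_cancel_right]
      _ ≤ |f₂ T + a * f₁ T| + |a * f₁ T| := abs_sub _ _
      _ ≤ 2 * M := by linarith
  calc f₁ T ^ 2 + f₂ T ^ 2 = |f₁ T| ^ 2 + |f₂ T| ^ 2 := by rw [sq_abs, sq_abs]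
    _ ≤ (M / a) ^ 2 + (2 * M) ^ 2 := by gcongr
    _ = _ := by ring

end OverdampedFilter

/-! ### A priori bound for the remaining physical states -/

namespace GFM

variable {Ω : Circuit} {D : Design}

theorem norm_rest_sq (x : State) : ‖x.rest‖ ^ 2 = (x.vcd ^ 2 + x.vcq ^ 2 + x.igd ^ 2 + x.igq ^ 2)
    + (x.q₁ ^ 2 + x.q₂ ^ 2) + (x.p₁ ^ 2 + x.p₂ ^ 2) := by
  simp only [EuclideanSpace.norm_sq_eq, Fin.sum_univ_eight, State.rest, Real.norm_eq_abs, sq_abs,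
    Matrix.cons_val]
  ring

theorem abs_p_le (x : State) : |x.p| ≤ x.vcd ^ 2 + x.vcq ^ 2 + x.igd ^ 2 + x.igq ^ 2 := by
  rw [State.p, abs_le]
  constructor <;> nlinarith [sq_nonneg (x.vcd - x.igd), sq_nonneg (x.vcq - x.igq),
    sq_nonneg (x.vcd + x.igd), sq_nonneg (x.vcq + x.igq)]

theorem abs_q_le (x : State) : |x.q| ≤ x.vcd ^ 2 + x.vcq ^ 2 + x.igd ^ 2 + x.igq ^ 2 := by
  rw [State.q, abs_le]
  constructor <;> nlinarith [sq_nonneg (x.vcq - x.igd), sq_nonneg (x.vcd - x.igq),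
    sq_nonneg (x.vcq + x.igd), sq_nonneg (x.vcd + x.igq)]

theorem exists_rest_bound (Ω : Circuit) (D : Design) :
    ∃ B : State × ℝ≥0 × ℝ≥0 → ℝ≥0, Continuous B ∧
      ∀ vgd vgq : ℝ → ℝ, IsBoundedSignal vgd → IsBoundedSignal vgq → ∀ T, 0 ≤ T → ∀ y,
        IsSolutionUpTo Ω D vgd vgq T y → (y 0).1 ∈ safeSet D →
        ‖(y T).1.rest‖ ≤ B ((y 0).1, supNorm vgd, supNorm vgq) := by
  obtain ⟨B, hB, hgrid⟩ := exists_grid_bound Ω D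
  obtain ⟨a, b, ha, hb, hab, hab'⟩ := exists_real_poles D.ωqc_pos D.one_lt_ξq
  obtain ⟨c, d, hc, hd, hcd, hcd'⟩ := exists_real_poles D.ωpc_pos D.one_lt_ξp
  have hq₁ := locallyLipschitz_q₁.continuous
  have hq₂ := locallyLipschitz_q₂.continuous
  have hp₁ := locallyLipschitz_p₁.continuous
  have hp₂ := locallyLipschitz_p₂.continuous
  refine ⟨fun w => (√(B w + (1 / a ^ 2 + 4) * (|w.1.q₂| + a * (|w.1.q₁| + B w)) ^ 2
    + (1 / c ^ 2 + 4) * (|w.1.p₂| + c * (|w.1.p₁| + B w)) ^ 2)).toNNReal, by fun_prop, ?_⟩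
  intro vgd vgq hvd hvq T hT y hy h0
  refine (Real.le_sqrt_of_sq_le ?_).trans (Real.le_coe_toNNReal _)
  have hgrid_t : ∀ t ∈ Ioo 0 T, _ ≤ _ := fun t ht =>
    hgrid vgd vgq hvd hvq t ht.1.le y (hy.mono ht.1.le ht.2.le) h0
  have hac {g : State → ℝ} (hg : LocallyLipschitz g) :
      AbsolutelyContinuousOnInterval (fun s => g (y s).1) 0 T :=
    hy.absolutelyContinuous_comp (g := fun z : FullState => g z.1) (by fun_prop)
  rw [norm_rest_sq]
  refine add_le_add (add_le_add (hgrid vgd vgq hvd hvq T hT y hy h0) ?_) ?_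
  · refine sq_add_sq_le_of_overdamped_filter ha hb hT (hac locallyLipschitz_q₁)
      (hac locallyLipschitz_q₂) ?_ ?_ (NNReal.coe_nonneg _) fun t ht =>
        (abs_sat_le D.Qbar_pos _).trans ((abs_q_le _).trans (hgrid_t t ht))
    · filter_upwards [ae_hasDerivAt_fst hy] with t ht hmem using hasDerivAt_q₁ (ht hmem)
    · filter_upwards [ae_hasDerivAt_fst hy] with t ht hmem
      simpa only [hab, hab', neg_mul] using hasDerivAt_q₂ (ht hmem)
  · refine sq_add_sq_le_of_overdamped_filter hc hd hT (hac locallyLipschitz_p₁)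
      (hac locallyLipschitz_p₂) ?_ ?_ (NNReal.coe_nonneg _) fun t ht =>
        (abs_sat_le D.Pbar_pos _).trans ((abs_p_le _).trans (hgrid_t t ht))
    · filter_upwards [ae_hasDerivAt_fst hy] with t ht hmem using hasDerivAt_p₁ (ht hmem)
    · filter_upwards [ae_hasDerivAt_fst hy] with t ht hmem
      simpa only [hcd, hcd', neg_mul] using hasDerivAt_p₂ (ht hmem)

end GFM

/-! ### Tracking errors under the nominal control -/

namespace GFM

variable {Ω : Circuit} {D : Design}

section TrackingErrors

variable {a b t zd zq : ℝ} {vt : Fin 2 → ℝ} {x : ℝ → State}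

theorem hasDerivAt_freq (h : HasDerivAt x (plantField Ω D a b vt (x t)) t) :
    HasDerivAt (fun s => freq D (x s)) (-(D.KP * (x t).p₂)) t :=
  ((((hasDerivAt_p₁ h).const_sub D.P₀).const_mul D.KP).const_add D.ω₀).congr_deriv
    (mul_neg _ _)

theorem hasDerivAt_vcd_sub_vcdRef (h : HasDerivAt x (plantField Ω D a b vt (x t)) t) :
    HasDerivAt (fun s => (x s).vcd - vcdRef D (x s))
      (-D.KVC * ((x t).vcd - vcdRef D (x t)) + Ω.ωb / Ω.Cf * ((x t).itd - itdRef Ω D (x t))) t := by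
  have hω := Ω.ωb_pos.ne'
  have hC := Ω.Cf_pos.ne'
  refine ((hasDerivAt_vcd h).sub
    ((((hasDerivAt_q₁ h).const_sub D.Q₀).const_mul D.KQ).const_add D.V₀)).congr_deriv ?_
  unfold itdRef
  field_simp
  ring

theorem hasDerivAt_vcq_of_itqRef (h : HasDerivAt x (plantField Ω D a b vt (x t)) t) :
    HasDerivAt (fun s => (x s).vcq)
      (-D.KVC * (x t).vcq + Ω.ωb / Ω.Cf * ((x t).itq - itqRef Ω D (x t))) t := by
  have hω := Ω.ωb_pos.ne'
  have hC := Ω.Cf_pos.ne'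
  refine (hasDerivAt_vcq h).congr_deriv ?_
  unfold itqRef
  field_simp
  ring

theorem hasDerivAt_itd_sub_itdRef
    (h : HasDerivAt x (plantField Ω D a b (vtNom Ω D (x t, zd, zq)) (x t)) t) :
    HasDerivAt (fun s => (x s).itd - itdRef Ω D (x s))
      (ud Ω D (x t) zd - (Ω.ωb / Ω.L * ((x t).vcd - a) - Ω.ωb * Ω.R / Ω.L * (x t).igd)) t := by
  have hω := Ω.ωb_pos.ne'
  have hC := Ω.Cf_pos.ne'
  have hLf := Ω.Lf_pos.ne'
  have hL := Ω.L_pos.ne'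
  refine ((hasDerivAt_itd h).sub
    ((((hasDerivAt_igd h).sub (((hasDerivAt_freq h).const_mul Ω.Cf).mul (hasDerivAt_vcq h))).sub
    ((hasDerivAt_q₂ h).const_mul (Ω.Cf * D.KQ / Ω.ωb))).sub
    ((hasDerivAt_vcd_sub_vcdRef h).const_mul (Ω.Cf * D.KVC / Ω.ωb)))).congr_deriv ?_
  simp only [vtNom, Matrix.cons_val_zero]
  unfold vtdNom
  generalize itdRef Ω D (x t) = ref
  generalize ud Ω D (x t) zd = u
  generalize vcdRef D (x t) = vref
  generalize sat D.Qbar (x t).q = sq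
  field_simp
  ring

theorem hasDerivAt_itq_sub_itqRef
    (h : HasDerivAt x (plantField Ω D a b (vtNom Ω D (x t, zd, zq)) (x t)) t) :
    HasDerivAt (fun s => (x s).itq - itqRef Ω D (x s))
      (uq Ω D (x t) zq - (Ω.ωb / Ω.L * ((x t).vcq - b) - Ω.ωb * Ω.R / Ω.L * (x t).igq)) t := by
  have hω := Ω.ωb_pos.ne'
  have hC := Ω.Cf_pos.ne'
  have hLf := Ω.Lf_pos.ne'
  have hL := Ω.L_pos.ne'
  refine ((hasDerivAt_itq h).sub
    (((hasDerivAt_igq h).add (((hasDerivAt_freq h).const_mul Ω.Cf).mul (hasDerivAt_vcd h))).sub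
    ((hasDerivAt_vcq_of_itqRef h).const_mul (Ω.Cf * D.KVC / Ω.ωb)))).congr_deriv ?_
  simp only [vtNom, Matrix.cons_val_one, Matrix.cons_val_fin_one]
  unfold vtqNom
  generalize itqRef Ω D (x t) = ref
  generalize uq Ω D (x t) zq = u
  field_simp
  ring

end TrackingErrors

/-! ### Dissipation of the tracking energies -/

theorem sq_grid_disturbance_le {v i r g n : ℝ} (hg : |g| ≤ n) :
    (g - v + r * i) ^ 2 ≤ (1 + i ^ 2 + v ^ 2) * (1 + r ^ 2 + n ^ 2) :=
  calc (g - v + r * i) ^ 2 ≤ (1 + i ^ 2 + v ^ 2) * (1 + r ^ 2 + g ^ 2) := by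
        linarith [sq_nonneg (v * g + 1), sq_nonneg (v * r + i), sq_nonneg (g * i - r)]
    _ ≤ (1 + i ^ 2 + v ^ 2) * (1 + r ^ 2 + n ^ 2) := by
        gcongr (1 + i ^ 2 + v ^ 2) * (1 + r ^ 2 + ?_)
        exact sq_le_sq.2 (hg.trans (le_abs_self n))

theorem mul_sub_mul_sq_le_div {A s d m : ℝ} (hA : 0 < A) (hd : d ^ 2 ≤ m) :
    s * d - A * s ^ 2 ≤ m / (4 * A) := by
  rw [le_div_iff₀ (by positivity)]
  linarith [sq_nonneg (2 * A * s - d)]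

/-- The level `μ (1 + R² + n²) / L²` of the disturbance by a grid voltage bounded by `n`, as seen by
the tracking energy of one axis with damping constant `μ`. -/
noncomputable def disturbanceLevel (Ω : Circuit) (μ n : ℝ) : ℝ :=
  μ * (1 + Ω.R ^ 2 + n ^ 2) / Ω.L ^ 2

/-- The rate at which the tracking energies decay under the nominal control. -/
noncomputable def decayRate (D : Design) : ℝ := 2 * min D.KVC D.KCC

theorem decayRate_pos (D : Design) : 0 < decayRate D :=
  mul_pos two_pos (lt_min D.KVC_pos D.KCC_pos)

theorem nonlinear_damping_le {μ n ζ g v i s : ℝ} (hμ : 0 < μ) (hζ : 0 < ζ) (hg : |g| ≤ n) :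
    -((1 + ζ) * Ω.ωb ^ 2 / (4 * μ) * (1 + i ^ 2 + v ^ 2)) * s ^ 2
        - s * (Ω.ωb / Ω.L * (v - g) - Ω.ωb * Ω.R / Ω.L * i)
      ≤ disturbanceLevel Ω μ n / (1 + ζ) := by
  have hω := Ω.ωb_pos
  have hL := Ω.L_pos
  have hd : (Ω.ωb / Ω.L * (g - v + Ω.R * i)) ^ 2
      ≤ (Ω.ωb / Ω.L) ^ 2 * ((1 + i ^ 2 + v ^ 2) * (1 + Ω.R ^ 2 + n ^ 2)) := by
    rw [mul_pow]
    gcongr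
    exact sq_grid_disturbance_le hg
  have hA : 0 < (1 + ζ) * Ω.ωb ^ 2 / (4 * μ) * (1 + i ^ 2 + v ^ 2) := by positivity
  calc _ = s * (Ω.ωb / Ω.L * (g - v + Ω.R * i))
        - (1 + ζ) * Ω.ωb ^ 2 / (4 * μ) * (1 + i ^ 2 + v ^ 2) * s ^ 2 := by ring
    _ ≤ _ := mul_sub_mul_sq_le_div hA hd
    _ = _ := by unfold disturbanceLevel; field_simp

theorem dissipation_le {μ n ζ c g v i e s : ℝ} (hμ : 0 < μ) (hζ : 0 < ζ) (hg : |g| ≤ n) :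
    e * (-D.KVC * e + c * s)
        + s * (-(D.KCC + (1 + ζ) * Ω.ωb ^ 2 / (4 * μ) * (1 + i ^ 2 + v ^ 2)) * s - c * e
          - (Ω.ωb / Ω.L * (v - g) - Ω.ωb * Ω.R / Ω.L * i))
      ≤ -decayRate D * (1 / 2 * e ^ 2 + 1 / 2 * s ^ 2) + disturbanceLevel Ω μ n / (1 + ζ) := by
  have hvoltage := mul_le_mul_of_nonneg_right (min_le_left D.KVC D.KCC) (sq_nonneg e)
  have hcurrent := mul_le_mul_of_nonneg_right (min_le_right D.KVC D.KCC) (sq_nonneg s)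
  have hdamping := nonlinear_damping_le (Ω := Ω) (v := v) (i := i) (s := s) hμ hζ hg
  unfold decayRate
  linarith

section EnergyDecay

variable {a b n t zd zq : ℝ} {x : ℝ → State}

theorem deriv_Wd_le (h : HasDerivAt x (plantField Ω D a b (vtNom Ω D (x t, zd, zq)) (x t)) t)
    (ha : |a| ≤ n) : deriv (fun s => Wd Ω D (x s)) t
      ≤ -decayRate D * Wd Ω D (x t) + disturbanceLevel Ω D.μd n / (1 + Real.exp zd) := by
  have hW : HasDerivAt (fun s => Wd Ω D (x s)) _ t :=
    (((hasDerivAt_vcd_sub_vcdRef h).pow 2).const_mul (1 / 2)).add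
      (((hasDerivAt_itd_sub_itdRef h).pow 2).const_mul (1 / 2))
  rw [hW.deriv]
  refine le_of_eq_of_le ?_ (dissipation_le (c := Ω.ωb / Ω.Cf) (v := (x t).vcd) (i := (x t).igd)
    D.μd_pos (Real.exp_pos zd) ha)
  rw [ud]
  ring

theorem deriv_Wq_le (h : HasDerivAt x (plantField Ω D a b (vtNom Ω D (x t, zd, zq)) (x t)) t)
    (hb : |b| ≤ n) : deriv (fun s => Wq Ω D (x s)) t
      ≤ -decayRate D * Wq Ω D (x t) + disturbanceLevel Ω D.μq n / (1 + Real.exp zq) := by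
  have hW : HasDerivAt (fun s => Wq Ω D (x s)) _ t :=
    (((hasDerivAt_vcq_of_itqRef h).pow 2).const_mul (1 / 2)).add
      (((hasDerivAt_itq_sub_itqRef h).pow 2).const_mul (1 / 2))
  rw [hW.deriv]
  refine le_of_eq_of_le ?_ (dissipation_le (c := Ω.ωb / Ω.Cf) (v := (x t).vcq) (i := (x t).igq)
    D.μq_pos (Real.exp_pos zq) hb)
  rw [uq]
  ring

end EnergyDecay

variable {vgd vgq : ℝ → ℝ} {T : ℝ} {y : ℝ → FullState}

theorem ae_hasDerivAt_fst_of_notMem_onSet (hy : IsSolutionUpTo Ω D vgd vgq T y) :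
    ∀ᵐ t, t ∈ Ioo 0 T → t ∉ onSet Ω D y → HasDerivAt (fun s => (y s).1)
      (plantField Ω D (vgd t) (vgq t) (vtNom Ω D (y t)) (y t).1) t := by
  filter_upwards [ae_hasDerivAt_fst hy] with t ht hmem hoff
  have hslack : 0 ≤ eta Ω D (y t).1 (vtNom Ω D (y t)) := not_lt.1 fun h => hoff ⟨hmem.1.le, h⟩
  simpa only [safetyFilter, if_pos hslack] using ht hmem

theorem ae_deriv_Wd_le (hvd : IsBoundedSignal vgd) (hy : IsSolutionUpTo Ω D vgd vgq T y) :
    ∀ᵐ t, t ∈ Ioo 0 T → t ∉ onSet Ω D y → deriv (fun s => Wd Ω D (y s).1) t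
      ≤ -decayRate D * Wd Ω D (y t).1
        + disturbanceLevel Ω D.μd (supNorm vgd) / (1 + Real.exp (y t).2.1) := by
  filter_upwards [ae_hasDerivAt_fst_of_notMem_onSet hy, hvd.ae_abs_le] with t ht hbd hmem hoff
  exact deriv_Wd_le (ht hmem hoff) (hbd hmem.1)

theorem ae_deriv_Wq_le (hvq : IsBoundedSignal vgq) (hy : IsSolutionUpTo Ω D vgd vgq T y) :
    ∀ᵐ t, t ∈ Ioo 0 T → t ∉ onSet Ω D y → deriv (fun s => Wq Ω D (y s).1) t
      ≤ -decayRate D * Wq Ω D (y t).1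
        + disturbanceLevel Ω D.μq (supNorm vgq) / (1 + Real.exp (y t).2.2) := by
  filter_upwards [ae_hasDerivAt_fst_of_notMem_onSet hy, hvq.ae_abs_le] with t ht hbd hmem hoff
  exact deriv_Wq_le (ht hmem hoff) (hbd hmem.1)

end GFM

/-! ### Functions that decay outside finitely many intervals -/

section DecayOffIntervals

theorem ordConnected_ae_eq_Ioc {J : Set ℝ} (hJ : J.OrdConnected) (hbelow : BddBelow J)
    (habove : BddAbove J) : J =ᵐ[volume] Ioc (sInf J) (sSup J) := by
  have hIoo : Ioo (sInf J) (sSup J) ⊆ J := by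
    rcases J.eq_empty_or_nonempty with rfl | hne
    · simp
    intro t ht
    obtain ⟨r, hr, hrt⟩ := exists_lt_of_csInf_lt hne ht.1
    obtain ⟨s, hs, hts⟩ := exists_lt_of_lt_csSup hne ht.2
    exact hJ.out hr hs ⟨hrt.le, hts.le⟩
  have hIcc : J ⊆ Icc (sInf J) (sSup J) := fun t ht => ⟨csInf_le hbelow ht, le_csSup habove ht⟩
  exact (hIcc.eventuallyLE.trans Ioc_ae_eq_Icc.symm.le).antisymm
    (Ioo_ae_eq_Ioc.symm.le.trans hIoo.eventuallyLE)

variable {w : ℝ → ℝ} {a b k M : ℝ} {𝒥 : Finset (Set ℝ)} {τ : ℝ≥0}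

theorem setIntegral_deriv_le (hw : AbsolutelyContinuousOnInterval w a b) (hM₀ : 0 ≤ M)
    (hM : ∀ t ∈ Icc a b, w t ∈ Icc 0 M) {J : Set ℝ} (hJ : J.OrdConnected) (hJs : J ⊆ Ioc a b) :
    ∫ t in J, deriv w t ≤ M := by
  rcases J.eq_empty_or_nonempty with rfl | hne
  · simpa using hM₀
  have hbelow : BddBelow J := bddBelow_Ioc.mono hJs
  have habove : BddAbove J := bddAbove_Ioc.mono hJs
  have hinf : a ≤ sInf J := le_csInf hne fun t ht => (hJs ht).1.le
  have hsup : sSup J ≤ b := csSup_le hne fun t ht => (hJs ht).2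
  have hle : sInf J ≤ sSup J := csInf_le_csSup hne hbelow habove
  have hsub : uIcc (sInf J) (sSup J) ⊆ uIcc a b := by
    rw [uIcc_of_le hle, uIcc_of_le (hinf.trans (hle.trans hsup))]
    exact Icc_subset_Icc hinf hsup
  rw [setIntegral_congr_set (ordConnected_ae_eq_Ioc hJ hbelow habove),
    ← intervalIntegral.integral_of_le hle, (hw.mono hsub).integral_deriv_eq_sub]
  linarith [(hM _ ⟨hinf, hle.trans hsup⟩).1, (hM _ ⟨hinf.trans hle, hsup⟩).2]

theorem setIntegral_inter_biUnion_deriv_le (hab : a ≤ b)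
    (hw : AbsolutelyContinuousOnInterval w a b) (hM : ∀ t ∈ Icc a b, w t ∈ Icc 0 M)
    (hJ : ∀ J ∈ 𝒥, J.OrdConnected) (hdisj : (𝒥 : Set (Set ℝ)).PairwiseDisjoint id) :
    ∫ t in Ioc a b ∩ ⋃ J ∈ 𝒥, J, deriv w t ≤ 𝒥.card * M := by
  have hM₀ : 0 ≤ M := nonempty_Icc.1 ⟨_, hM a (left_mem_Icc.2 hab)⟩
  have hint : IntegrableOn (deriv w) (Ioc a b) :=
    (intervalIntegrable_iff_integrableOn_Ioc_of_le hab).1 hw.intervalIntegrable_deriv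
  rw [inter_iUnion₂, integral_biUnion_finset 𝒥
    (fun J h => measurableSet_Ioc.inter (hJ J h).measurableSet)
    (fun J hJ J' hJ' hne => (hdisj hJ hJ' hne).mono inter_subset_right inter_subset_right)
    (fun J _ => hint.mono_set inter_subset_left), ← nsmul_eq_mul]
  exact Finset.sum_le_card_nsmul 𝒥 _ M fun J h =>
    setIntegral_deriv_le hw hM₀ hM (ordConnected_Ioc.inter (hJ J h)) inter_subset_left

theorem setIntegral_le_mul_of_volume_le {s : Set ℝ} (hs : MeasurableSet s)
    (hvol : volume s ≤ τ) (hint : IntegrableOn w s) (hM₀ : 0 ≤ M) (hM : ∀ t ∈ s, w t ≤ M) :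
    ∫ t in s, w t ≤ M * τ :=
  calc ∫ t in s, w t ≤ ∫ _ in s, M :=
        setIntegral_mono_on hint
          (integrableOn_const (hvol.trans_lt ENNReal.coe_lt_top).ne) hs hM
    _ = M * volume.real s := by rw [setIntegral_const, smul_eq_mul, mul_comm]
    _ ≤ M * τ := by
        gcongr
        exact ENNReal.toReal_le_of_le_ofReal τ.2 (by rwa [ENNReal.ofReal_coe_nnreal])

theorem integral_le_of_decay_off (hab : a ≤ b) (hw : AbsolutelyContinuousOnInterval w a b)
    (hM : ∀ t ∈ Icc a b, w t ∈ Icc 0 M) (hk : 0 < k) (hJ : ∀ J ∈ 𝒥, J.OrdConnected)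
    (hdisj : (𝒥 : Set (Set ℝ)).PairwiseDisjoint id) (hvol : volume (⋃ J ∈ 𝒥, J) ≤ τ)
    (hdec : ∀ᵐ t, t ∈ Ioo a b → t ∉ ⋃ J ∈ 𝒥, J → deriv w t ≤ -k * w t) :
    ∫ t in a..b, w t ≤ M * τ + (𝒥.card + 1) * M / k := by
  have hMa := hM a (left_mem_Icc.2 hab)
  have hMb := hM b (right_mem_Icc.2 hab)
  have hon_deriv := setIntegral_inter_biUnion_deriv_le hab hw hM hJ hdisj
  obtain ⟨S, hS⟩ : ∃ S, S = ⋃ J ∈ 𝒥, J := ⟨_, rfl⟩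
  have hSm : MeasurableSet S :=
    hS ▸ Finset.measurableSet_biUnion _ fun J h => (hJ J h).measurableSet
  rw [← hS] at hon_deriv hvol hdec
  have hiw : IntegrableOn w (Ioc a b) :=
    (intervalIntegrable_iff_integrableOn_Ioc_of_le hab).1 hw.continuousOn.intervalIntegrable
  have hidw : IntegrableOn (deriv w) (Ioc a b) :=
    (intervalIntegrable_iff_integrableOn_Ioc_of_le hab).1 hw.intervalIntegrable_deriv
  have hderiv := integral_inter_add_sdiff hSm hidw
  rw [← intervalIntegral.integral_of_le hab, hw.integral_deriv_eq_sub] at hderiv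
  have hsplit := integral_inter_add_sdiff hSm hiw
  rw [← intervalIntegral.integral_of_le hab] at hsplit
  have hon : ∫ t in Ioc a b ∩ S, w t ≤ M * τ :=
    setIntegral_le_mul_of_volume_le (measurableSet_Ioc.inter hSm)
      ((measure_mono inter_subset_right).trans hvol) (hiw.mono_set inter_subset_left)
      (hMa.1.trans hMa.2) fun t ht => (hM t (Ioc_subset_Icc_self ht.1)).2
  have hoff_deriv : ∫ t in Ioc a b \ S, deriv w t ≤ -k * ∫ t in Ioc a b \ S, w t := by
    rw [← integral_const_mul]
    refine setIntegral_mono_on_ae (hidw.mono_set sdiff_subset)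
      ((hiw.mono_set sdiff_subset).const_mul _) (measurableSet_Ioc.diff hSm) ?_
    filter_upwards [hdec, volume.ae_ne b] with t ht hne hmem
    exact ht ⟨hmem.1.1, hmem.1.2.lt_of_ne hne⟩ hmem.2
  have hoff : ∫ t in Ioc a b \ S, w t ≤ (𝒥.card + 1) * M / k := by
    rw [le_div_iff₀ hk]
    linarith [hMa.2, hMb.1]
  linarith

theorem deriv_max_sub_const_le {W : ℝ → ℝ} {ε t : ℝ} (hW : DifferentiableAt ℝ W t)
    (hd : deriv W t ≤ -k * (W t - ε)) :
    deriv (fun s => max (W s - ε) 0) t ≤ -k * max (W t - ε) 0 := by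
  rcases le_or_gt (W t) ε with h | h
  · have h₀ : max (W t - ε) 0 = 0 := max_eq_right (sub_nonpos.2 h)
    have hmin : IsLocalMin (fun s => max (W s - ε) 0) t :=
      .of_forall fun s => h₀.le.trans (le_max_right _ _)
    rw [hmin.deriv_eq_zero, h₀, mul_zero]
  · have hev : (fun s => max (W s - ε) 0) =ᶠ[𝓝 t] fun s => W s - ε := by
      filter_upwards [hW.continuousAt.eventually_const_lt h] with s hs
      exact max_eq_left (sub_nonneg.2 hs.le)
    rwa [hev.deriv_eq, deriv_sub_const, max_eq_left (sub_nonneg.2 h.le)]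

end DecayOffIntervals

/-! ### Adaptive gains -/

/-- On `[a, b]`, the gain `z` is adapted by the energy signal `W` with rate `Γ` and dead zone `ε`:
`ż = Γ e^{-z} max (W - ε) 0`. -/
structure IsAdaptiveGainOn (Γ ε : ℝ) (W z : ℝ → ℝ) (a b : ℝ) : Prop where
  absCont_gain : AbsolutelyContinuousOnInterval z a b
  absCont_energy : AbsolutelyContinuousOnInterval W a b
  ode : ∀ᵐ t, t ∈ Ioo a b → HasDerivAt z (Γ * Real.exp (-z t) * max (W t - ε) 0) t

namespace IsAdaptiveGainOn

variable {Γ ε M a b c d σ ϑ : ℝ} {W z : ℝ → ℝ} {𝒥 : Finset (Set ℝ)} {τ : ℝ≥0}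

theorem mono (h : IsAdaptiveGainOn Γ ε W z a b) (hac : a ≤ c) (hcd : c ≤ d) (hdb : d ≤ b) :
    IsAdaptiveGainOn Γ ε W z c d := by
  have hsub : uIcc c d ⊆ uIcc a b := by
    rw [uIcc_of_le hcd, uIcc_of_le (hac.trans (hcd.trans hdb))]
    exact Icc_subset_Icc hac hdb
  refine ⟨h.absCont_gain.mono hsub, h.absCont_energy.mono hsub, ?_⟩
  filter_upwards [h.ode] with t ht hmem using ht (Ioo_subset_Ioo hac hdb hmem)

theorem gain_le (h : IsAdaptiveGainOn Γ ε W z a b) (hΓ : 0 ≤ Γ) (hab : a ≤ b) : z a ≤ z b := by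
  refine le_of_ae_deriv_nonneg h.absCont_gain hab ?_
  filter_upwards [h.ode] with t ht hmem
  rw [(ht hmem).deriv]
  positivity

theorem absCont_exp (h : IsAdaptiveGainOn Γ ε W z a b) :
    AbsolutelyContinuousOnInterval (fun t => Real.exp (z t)) a b :=
  absolutelyContinuousOnInterval_comp_of_locallyLipschitz (g := Real.exp) h.absCont_gain
    (by fun_prop)

theorem ae_deriv_exp (h : IsAdaptiveGainOn Γ ε W z a b) :
    ∀ᵐ t, t ∈ Ioo a b → deriv (fun s => Real.exp (z s)) t = Γ * max (W t - ε) 0 := by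
  filter_upwards [h.ode] with t ht hmem
  rw [(ht hmem).exp.deriv, Real.exp_neg]
  field_simp

theorem exp_gain_le_add_mul (h : IsAdaptiveGainOn Γ ε W z a b) (hΓ : 0 ≤ Γ) (hε : 0 ≤ ε)
    (hab : a ≤ b) (hM₀ : 0 ≤ M) (hM : ∀ t ∈ Icc a b, W t ≤ M) :
    Real.exp (z b) ≤ Real.exp (z a) + Γ * M * (b - a) := by
  refine le_add_mul_of_ae_deriv_le h.absCont_exp hab ?_
  filter_upwards [h.ae_deriv_exp] with t ht hmem
  rw [ht hmem]
  gcongr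
  exact max_le (by linarith [hM t (Ioo_subset_Icc_self hmem)]) hM₀

theorem abs_gain_le (h : IsAdaptiveGainOn Γ ε W z a b) (hΓ : 0 ≤ Γ) (hε : 0 ≤ ε) (hab : a ≤ b)
    (hM₀ : 0 ≤ M) (hM : ∀ t ∈ Icc a b, W t ≤ M) (hc : b - a ≤ c) :
    |z b| ≤ |z a| + |Real.log (Real.exp (z a) + Γ * M * c)| := by
  have hexp : Real.exp (z b) ≤ Real.exp (z a) + Γ * M * c :=
    (h.exp_gain_le_add_mul hΓ hε hab hM₀ hM).trans (by gcongr)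
  have hlog : z b ≤ Real.log (Real.exp (z a) + Γ * M * c) :=
    (Real.le_log_iff_exp_le ((Real.exp_pos _).trans_le hexp)).2 hexp
  rw [abs_le]
  constructor <;> linarith [h.gain_le hΓ hab, neg_abs_le (z a), abs_nonneg (z a), le_abs_self
    (Real.log (Real.exp (z a) + Γ * M * c)), abs_nonneg (Real.log (Real.exp (z a) + Γ * M * c))]

theorem exp_gain_sub_eq (h : IsAdaptiveGainOn Γ ε W z a b) (hab : a ≤ b) :
    Real.exp (z b) - Real.exp (z a) = Γ * ∫ t in a..b, max (W t - ε) 0 := by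
  rw [← h.absCont_exp.integral_deriv_eq_sub, ← intervalIntegral.integral_const_mul]
  refine intervalIntegral.integral_congr_ae ?_
  filter_upwards [h.ae_deriv_exp, volume.ae_ne b] with t ht hne hmem
  rw [uIoc_of_le hab] at hmem
  exact ht ⟨hmem.1, hmem.2.lt_of_ne hne⟩

/-- Once `e^z` exceeds the threshold `ϑ / (σ ε)`, the excess energy `max (W - ε) 0` decays. -/
theorem exp_gain_le_of_threshold_le (h : IsAdaptiveGainOn Γ ε W z a b) (hΓ : 0 ≤ Γ) (hε : 0 < ε)
    (hσ : 0 < σ) (hab : a ≤ b) (hM₀ : 0 ≤ M) (hM : ∀ t ∈ Icc a b, W t ≤ M)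
    (hJ : ∀ J ∈ 𝒥, J.OrdConnected) (hdisj : (𝒥 : Set (Set ℝ)).PairwiseDisjoint id)
    (hvol : volume (⋃ J ∈ 𝒥, J) ≤ τ)
    (hdec : ∀ᵐ t, t ∈ Ioo a b → t ∉ ⋃ J ∈ 𝒥, J →
      deriv W t ≤ -σ * W t + ϑ / (1 + Real.exp (z t)))
    (hthreshold : ϑ / (σ * ε) ≤ Real.exp (z a)) :
    Real.exp (z b) ≤ Real.exp (z a) + Γ * (M * τ + (𝒥.card + 1) * M / σ) := by
  have hac : AbsolutelyContinuousOnInterval (fun t => max (W t - ε) 0) a b :=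
    absolutelyContinuousOnInterval_comp_of_locallyLipschitz (g := fun x => max (x - ε) 0)
      h.absCont_energy (by fun_prop)
  have hint : ∫ t in a..b, max (W t - ε) 0 ≤ M * τ + (𝒥.card + 1) * M / σ := by
    refine integral_le_of_decay_off hab hac
      (fun t ht => ⟨le_max_right _ _, max_le (by linarith [hM t ht]) hM₀⟩) hσ hJ hdisj hvol ?_
    filter_upwards [hdec, ae_hasDerivAt_of_absolutelyContinuousOnInterval h.absCont_energy hab]
      with t ht hder hmem hoff
    refine deriv_max_sub_const_le (hder hmem).differentiableAt ((ht hmem hoff).trans ?_)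
    have hzt : ϑ / (σ * ε) ≤ Real.exp (z t) :=
      hthreshold.trans
        (Real.exp_le_exp.2 ((h.mono le_rfl hmem.1.le hmem.2.le).gain_le hΓ hmem.1.le))
    have hsmall : ϑ / (1 + Real.exp (z t)) ≤ σ * ε := by
      rw [div_le_iff₀ (by positivity)] at hzt ⊢
      linarith [mul_pos hσ hε]
    linarith
  linarith [h.exp_gain_sub_eq hab, mul_le_mul_of_nonneg_left hint hΓ]

theorem exp_gain_le_max_add (h : IsAdaptiveGainOn Γ ε W z a b) (hΓ : 0 ≤ Γ) (hε : 0 < ε)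
    (hσ : 0 < σ) (hab : a ≤ b) (hM₀ : 0 ≤ M) (hM : ∀ t ∈ Icc a b, W t ≤ M)
    (hJ : ∀ J ∈ 𝒥, J.OrdConnected) (hdisj : (𝒥 : Set (Set ℝ)).PairwiseDisjoint id)
    (hvol : volume (⋃ J ∈ 𝒥, J) ≤ τ)
    (hdec : ∀ᵐ t, t ∈ Ioo a b → t ∉ ⋃ J ∈ 𝒥, J →
      deriv W t ≤ -σ * W t + ϑ / (1 + Real.exp (z t))) :
    Real.exp (z b) ≤
      max (Real.exp (z a)) (ϑ / (σ * ε)) + Γ * (M * τ + (𝒥.card + 1) * M / σ) := by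
  have htail : ∀ r ∈ Icc a b, ϑ / (σ * ε) ≤ Real.exp (z r) →
      Real.exp (z b) ≤ Real.exp (z r) + Γ * (M * τ + (𝒥.card + 1) * M / σ) := fun r hr hzr => by
    refine (h.mono hr.1 hr.2 le_rfl).exp_gain_le_of_threshold_le hΓ hε hσ hr.2 hM₀
      (fun t ht => hM t (Icc_subset_Icc_left hr.1 ht)) hJ hdisj hvol ?_ hzr
    filter_upwards [hdec] with t ht hmem using ht (Ioo_subset_Ioo_left hr.1 hmem)
  have hnonneg : 0 ≤ Γ * (M * τ + (𝒥.card + 1) * M / σ) := by positivity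
  rcases le_total (ϑ / (σ * ε)) (Real.exp (z a)) with hstart | hstart
  · exact (htail a (left_mem_Icc.2 hab) hstart).trans (by gcongr; exact le_max_left _ _)
  rcases le_total (Real.exp (z b)) (ϑ / (σ * ε)) with hend | hend
  · exact hend.trans ((le_max_right _ _).trans (le_add_of_nonneg_right hnonneg))
  have hcont : ContinuousOn (fun t => Real.exp (z t)) (Icc a b) :=
    uIcc_of_le hab ▸ h.absCont_exp.continuousOn
  obtain ⟨r, hr, hzr : Real.exp (z r) = ϑ / (σ * ε)⟩ :=
    intermediate_value_Icc hab hcont ⟨hstart, hend⟩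
  exact (htail r hr hzr.ge).trans (by rw [hzr]; gcongr; exact le_max_right _ _)

end IsAdaptiveGainOn

/-! ### Global existence -/

namespace GFM

variable {Ω : Circuit} {D : Design} {vgd vgq : ℝ → ℝ} {T : ℝ} {y : ℝ → FullState}

theorem norm_state_le {x : State} {I b : ℝ} (hI : 0 ≤ I) (hx : x.itd ^ 2 + x.itq ^ 2 ≤ I ^ 2)
    (hb : ‖x.rest‖ ≤ b) : ‖x‖ ≤ I + b := by
  have hb₀ : 0 ≤ b := (norm_nonneg _).trans hb
  have hnorm : ‖x‖ ^ 2 = x.itd ^ 2 + x.itq ^ 2 + ‖x.rest‖ ^ 2 := by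
    rw [norm_rest_sq]
    simp only [EuclideanSpace.norm_sq_eq, Fin.sum_univ_succ, Real.norm_eq_abs, sq_abs]
    simp [State.vcd, State.vcq, State.itd, State.itq, State.igd, State.igq, State.q₁, State.q₂,
      State.p₁, State.p₂]
    ring
  refine le_of_sq_le_sq ?_ (by positivity)
  calc ‖x‖ ^ 2 ≤ I ^ 2 + b ^ 2 := by rw [hnorm]; gcongr
    _ ≤ (I + b) ^ 2 := by linarith [mul_nonneg hI hb₀, add_sq I b]

theorem exists_energy_bound_of_norm_le (Ω : Circuit) (D : Design) (r : ℝ) :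
    ∃ M : ℝ≥0, ∀ x : State, ‖x‖ ≤ r → Wd Ω D x ≤ M ∧ Wq Ω D x ≤ M := by
  have hcont : Continuous fun x => (Wd Ω D x, Wq Ω D x) :=
    (locallyLipschitz_Wd Ω D).continuous.prodMk (locallyLipschitz_Wq Ω D).continuous
  obtain ⟨M, hM⟩ := (isCompact_closedBall (0 : State) r).exists_bound_of_continuousOn
    hcont.continuousOn
  refine ⟨M.toNNReal, fun x hx => ?_⟩
  have hle := (hM x (mem_closedBall_zero_iff.2 hx)).trans (Real.le_coe_toNNReal M)
  exact ⟨(le_abs_self _).trans ((norm_fst_le _).trans hle),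
    (le_abs_self _).trans ((norm_snd_le _).trans hle)⟩

theorem exists_state_energy_bound (Ω : Circuit) (D : Design) :
    ∃ R : State × ℝ≥0 × ℝ≥0 → ℝ, ∃ M : State × ℝ≥0 × ℝ≥0 → ℝ≥0, ∀ vgd vgq,
      IsBoundedSignal vgd → IsBoundedSignal vgq → ∀ T, 0 ≤ T → ∀ y,
        IsSolutionUpTo Ω D vgd vgq T y → (y 0).1 ∈ safeSet D →
          ‖(y T).1‖ ≤ R ((y 0).1, supNorm vgd, supNorm vgq) ∧
          Wd Ω D (y T).1 ≤ M ((y 0).1, supNorm vgd, supNorm vgq) ∧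
          Wq Ω D (y T).1 ≤ M ((y 0).1, supNorm vgd, supNorm vgq) := by
  obtain ⟨B, -, hB⟩ := exists_rest_bound Ω D
  choose M hM using exists_energy_bound_of_norm_le Ω D
  refine ⟨fun p => D.Imax + B p, fun p => M (D.Imax + B p), fun vgd vgq hd hq T hT y hy h0 => ?_⟩
  have hnorm := norm_state_le D.Imax_pos.le (current_sq_le hT hy h0) (hB vgd vgq hd hq T hT y hy h0)
  exact ⟨hnorm, hM _ _ hnorm⟩

theorem isAdaptiveGainOn_d (hy : IsSolutionUpTo Ω D vgd vgq T y) :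
    IsAdaptiveGainOn D.Γd D.ε (fun t => Wd Ω D (y t).1) (fun t => (y t).2.1) 0 T where
  absCont_gain := hy.absolutelyContinuous_comp (g := fun z : FullState => z.2.1) (by fun_prop)
  absCont_energy :=
    hy.absolutelyContinuous_comp (g := fun z : FullState => Wd Ω D z.1) (by fun_prop)
  ode := by
    filter_upwards [hy.ode] with t ht hmem
    have h := ht hmem
    rw [← closedLoopField_eq] at h
    exact (hasFDerivAt_fst (𝕜 := ℝ)).comp_hasDerivAt t
      ((hasFDerivAt_snd (𝕜 := ℝ)).comp_hasDerivAt t h)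

theorem isAdaptiveGainOn_q (hy : IsSolutionUpTo Ω D vgd vgq T y) :
    IsAdaptiveGainOn D.Γq D.ε (fun t => Wq Ω D (y t).1) (fun t => (y t).2.2) 0 T where
  absCont_gain := hy.absolutelyContinuous_comp (g := fun z : FullState => z.2.2) (by fun_prop)
  absCont_energy :=
    hy.absolutelyContinuous_comp (g := fun z : FullState => Wq Ω D z.1) (by fun_prop)
  ode := by
    filter_upwards [hy.ode] with t ht hmem
    have h := ht hmem
    rw [← closedLoopField_eq] at h
    exact (hasFDerivAt_snd (𝕜 := ℝ)).comp_hasDerivAt t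
      ((hasFDerivAt_snd (𝕜 := ℝ)).comp_hasDerivAt t h)

theorem exists_norm_le_of_isSolutionUpTo (hd : IsBoundedSignal vgd) (hq : IsBoundedSignal vgq)
    {y₀ : FullState} (hy₀ : y₀.1 ∈ safeSet D) (T : ℝ) :
    ∃ R, ∀ τ, 0 ≤ τ → τ ≤ T → ∀ y, IsSolutionUpTo Ω D vgd vgq τ y → y 0 = y₀ → ‖y τ‖ ≤ R := by
  obtain ⟨R, M, hRM⟩ := exists_state_energy_bound Ω D
  let p := (y₀.1, supNorm vgd, supNorm vgq)
  refine ⟨max (R p) (max (|y₀.2.1| + |Real.log (Real.exp y₀.2.1 + D.Γd * M p * T)|)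
    (|y₀.2.2| + |Real.log (Real.exp y₀.2.2 + D.Γq * M p * T)|)), ?_⟩
  rintro τ hτ hτT y hy rfl
  have hbound : ∀ t ∈ Icc 0 τ, ‖(y t).1‖ ≤ R p ∧ Wd Ω D (y t).1 ≤ M p ∧ Wq Ω D (y t).1 ≤ M p :=
    fun t ht => hRM vgd vgq hd hq t ht.1 y (hy.mono ht.1 ht.2) hy₀
  refine max_le_max (hbound τ (right_mem_Icc.2 hτ)).1 (max_le_max ?_ ?_)
  · exact (isAdaptiveGainOn_d hy).abs_gain_le D.Γd_pos.le D.ε_pos.le hτ (M p).coe_nonneg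
      (fun t ht => (hbound t ht).2.1) (by simpa using hτT)
  · exact (isAdaptiveGainOn_q hy).abs_gain_le D.Γq_pos.le D.ε_pos.le hτ (M p).coe_nonneg
      (fun t ht => (hbound t ht).2.2) (by simpa using hτT)

theorem exists_isSolution (Ω : Circuit) (hd : IsBoundedSignal vgd) (hq : IsBoundedSignal vgq)
    {y₀ : FullState} (hy₀ : y₀.1 ∈ safeSet D) : ∃ y, IsSolution Ω D vgd vgq y ∧ y 0 = y₀ := by
  simp only [isSolution_iff_forall_isSolutionUpTo]
  exact exists_forall_isForcedSolutionOn (locallyLipschitz_closedLoopField Ω D 0 0)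
    (V := gridPrimitive Ω vgd vgq) (fun _ => absolutelyContinuous_gridPrimitive Ω hd hq)
    (ae_hasDerivAt_gridPrimitive Ω hd hq) y₀
    fun T _ => exists_norm_le_of_isSolutionUpTo hd hq hy₀ T

theorem IsSolution.eqOn {y' : ℝ → FullState} (h : IsSolution Ω D vgd vgq y)
    (h' : IsSolution Ω D vgd vgq y') (h0 : y 0 = y' 0) : EqOn y y' (Ici 0) := fun t ht =>
  (isSolution_iff_forall_isSolutionUpTo.1 h t ht).eqOn (locallyLipschitz_closedLoopField Ω D 0 0) ht
    (isSolution_iff_forall_isSolutionUpTo.1 h' t ht) h0 (right_mem_Icc.2 ht)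

end GFM

/-! ### Convergence of the adaptive gains -/

namespace GFM

variable {Ω : Circuit} {D : Design} {y : ℝ → FullState} {N : ℕ} {T : ℝ≥0}

theorem GainBoundedBy.mono {z : ℝ → ℝ} {B C : ℝ} (h : GainBoundedBy z B) (hBC : B ≤ C) :
    GainBoundedBy z C := by
  obtain ⟨hmono, l, hl, hz, hlB⟩ := h
  exact ⟨hmono, l, hl, hz, hlB.trans hBC⟩

theorem gainBoundedBy_log_of_exp_le {z : ℝ → ℝ} {C : ℝ} (hmono : MonotoneOn z (Ici 0))
    (hC : ∀ t, 0 ≤ t → Real.exp (z t) ≤ C) : GainBoundedBy z (Real.log C) := by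
  have hle : ∀ t, 0 ≤ t → z t ≤ Real.log C := fun t ht =>
    (Real.le_log_iff_exp_le ((Real.exp_pos _).trans_le (hC t ht))).2 (hC t ht)
  have hextend : Monotone fun t => z (max t 0) := fun s t hst =>
    hmono (le_max_right s 0) (le_max_right t 0) (max_le_max_right 0 hst)
  have hlim := tendsto_atTop_ciSup hextend
    ⟨Real.log C, forall_mem_range.2 fun t => hle _ (le_max_right t 0)⟩
  have hz : Tendsto z atTop (𝓝 (⨆ t, z (max t 0))) := by
    refine hlim.congr' ?_
    filter_upwards [eventually_ge_atTop 0] with t ht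
    rw [max_eq_left ht]
  refine ⟨hmono, _, hz, fun t ht => ⟨hmono self_mem_Ici ht ht, ?_⟩, ?_⟩
  · simpa only [max_eq_left ht] using hextend.ge_of_tendsto hlim t
  · exact le_of_tendsto' hlim fun t => hle _ (le_max_right t 0)

theorem exists_finset_episodes (hN : episodeCount Ω D y ≤ N) (hT : totalOnTime Ω D y ≤ T) :
    ∃ 𝒥 : Finset (Set ℝ), (∀ J ∈ 𝒥, J.OrdConnected) ∧ (𝒥 : Set (Set ℝ)).PairwiseDisjoint id ∧
      volume (⋃ J ∈ 𝒥, J) ≤ T ∧ (⋃ J ∈ 𝒥, J) = onSet Ω D y ∧ 𝒥.card ≤ N := by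
  have hfin : (episodes Ω D y).Finite := finite_of_encard_le_coe hN
  refine ⟨hfin.toFinset, fun J hJ => ?_, ?_, ?_, ?_, ?_⟩
  · obtain ⟨t, -, rfl⟩ := hfin.mem_toFinset.1 hJ
    infer_instance
  · intro J hJ J' hJ' hne
    obtain ⟨t, -, rfl⟩ := hfin.mem_toFinset.1 hJ
    obtain ⟨t', -, rfl⟩ := hfin.mem_toFinset.1 hJ'
    exact disjoint_left.2 fun s hs hs' =>
      hne ((ordConnectedComponent_eq hs).trans (ordConnectedComponent_eq hs').symm)
  · simp only [hfin.mem_toFinset]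
    exact (measure_biUnion_le volume hfin.countable _).trans hT
  · simp only [hfin.mem_toFinset]
    refine (iUnion₂_subset fun J hJ => ?_).antisymm fun s hs => ?_
    · obtain ⟨t, -, rfl⟩ := hJ
      exact ordConnectedComponent_subset
    · exact mem_biUnion (mem_image_of_mem _ hs) (self_mem_ordConnectedComponent.2 hs)
  · rw [episodeCount, hfin.encard_eq_coe_toFinset_card] at hN
    exact_mod_cast hN

/-- Bound for `e^z` along a gain `z` with rate `Γ` and initial value `z₀` that is driven by an
energy signal of size at most `M`, disturbed at level `ϑ`, when the safety filter is active during
at most `N` episodes of total length at most `T`. -/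
noncomputable def gainCap (D : Design) (Γ ϑ z₀ : ℝ) (M : ℝ≥0) (N : ℕ) (T : ℝ≥0) : ℝ :=
  max (Real.exp z₀) (ϑ / (decayRate D * D.ε)) + Γ * (M * T + (N + 1) * M / decayRate D)

theorem gainBoundedBy_log_gainCap {Γ ϑ : ℝ} {M : ℝ≥0} {W z : ℝ → ℝ}
    (hN : episodeCount Ω D y ≤ N) (hT : totalOnTime Ω D y ≤ T) (hΓ : 0 ≤ Γ)
    (h : ∀ t, 0 ≤ t → IsAdaptiveGainOn Γ D.ε W z 0 t) (hM : ∀ t, 0 ≤ t → W t ≤ M)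
    (hdec : ∀ t, 0 ≤ t → ∀ᵐ s, s ∈ Ioo 0 t → s ∉ onSet Ω D y →
      deriv W s ≤ -decayRate D * W s + ϑ / (1 + Real.exp (z s))) :
    GainBoundedBy z (Real.log (gainCap D Γ ϑ (z 0) M N T)) := by
  obtain ⟨𝒥, hJ, hdisj, hvol, hunion, hcard⟩ := exists_finset_episodes hN hT
  have hmono : MonotoneOn z (Ici 0) := fun s hs t ht hst =>
    ((h t ht).mono hs hst le_rfl).gain_le hΓ hst
  refine gainBoundedBy_log_of_exp_le hmono fun t ht => ?_
  have hrate := decayRate_pos D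
  refine ((h t ht).exp_gain_le_max_add hΓ D.ε_pos hrate ht M.coe_nonneg (fun s hs => hM s hs.1)
    hJ hdisj hvol (by rw [hunion]; exact hdec t ht)).trans ?_
  rw [gainCap]
  gcongr

theorem exists_gain_bound (Ω : Circuit) (D : Design) :
    ∃ B : State × ℝ × ℝ × ℝ≥0 × ℝ≥0 × ℕ × ℝ≥0 → ℝ≥0, ∀ vgd vgq,
      IsBoundedSignal vgd → IsBoundedSignal vgq → ∀ y, IsSolution Ω D vgd vgq y →
        (y 0).1 ∈ safeSet D → ∀ (N : ℕ) (T : ℝ≥0),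
          episodeCount Ω D y ≤ N → totalOnTime Ω D y ≤ T →
            GainBoundedBy (fun t => (y t).2.1)
              (B ((y 0).1, (y 0).2.1, (y 0).2.2, supNorm vgd, supNorm vgq, N, T)) ∧
            GainBoundedBy (fun t => (y t).2.2)
              (B ((y 0).1, (y 0).2.1, (y 0).2.2, supNorm vgd, supNorm vgq, N, T)) := by
  obtain ⟨_, M, hM⟩ := exists_state_energy_bound Ω D
  refine ⟨fun ⟨x₀, zd₀, zq₀, nd, nq, N, T⟩ => (max
    (Real.log (gainCap D D.Γd (disturbanceLevel Ω D.μd nd) zd₀ (M (x₀, nd, nq)) N T))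
    (Real.log (gainCap D D.Γq (disturbanceLevel Ω D.μq nq) zq₀ (M (x₀, nd, nq)) N T))).toNNReal,
    fun vgd vgq hd hq y hy h0 N T hN hT => ?_⟩
  rw [isSolution_iff_forall_isSolutionUpTo] at hy
  exact ⟨(gainBoundedBy_log_gainCap hN hT D.Γd_pos.le (fun t ht => isAdaptiveGainOn_d (hy t ht))
      (fun t ht => (hM vgd vgq hd hq t ht y (hy t ht) h0).2.1)
      fun t ht => ae_deriv_Wd_le hd (hy t ht)).mono
        ((le_max_left _ _).trans (Real.le_coe_toNNReal _)),
    (gainBoundedBy_log_gainCap hN hT D.Γq_pos.le (fun t ht => isAdaptiveGainOn_q (hy t ht))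
      (fun t ht => (hM vgd vgq hd hq t ht y (hy t ht) h0).2.2)
      fun t ht => ae_deriv_Wq_le hq (hy t ht)).mono
        ((le_max_right _ _).trans (Real.le_coe_toNNReal _))⟩

end GFM

theorem theorem4 (Ω : GFM.Circuit) (D : GFM.Design) :
    ∃ B₂ : GFM.State × ℝ≥0 × ℝ≥0 → ℝ≥0, Continuous B₂ ∧
    ∃ B₃ : GFM.State × ℝ × ℝ × ℝ≥0 × ℝ≥0 × ℕ × ℝ≥0 → ℝ≥0,
      ∀ vgd vgq : ℝ → ℝ, GFM.IsBoundedSignal vgd → GFM.IsBoundedSignal vgq →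
      ∀ x₀ ∈ GFM.safeSet D, ∀ zd₀ zq₀ : ℝ,
        ∃ y : ℝ → GFM.FullState,
          -- `y` is the unique solution with the given initial condition
          (GFM.IsSolution Ω D vgd vgq y ∧ y 0 = (x₀, zd₀, zq₀)) ∧
          (∀ y' : ℝ → GFM.FullState, GFM.IsSolution Ω D vgd vgq y' → y' 0 = (x₀, zd₀, zq₀) →
            Set.EqOn y' y (Set.Ici 0)) ∧
          -- safety and boundedness of the remaining physical states
          (∀ t : ℝ, 0 ≤ t →
            √((y t).1.itd ^ 2 + (y t).1.itq ^ 2) ≤ D.Imax ∧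
            ‖(y t).1.rest‖ ≤ B₂ (x₀, GFM.supNorm vgd, GFM.supNorm vgq)) ∧
          -- convergence and boundedness of the adaptive gains
          (∀ (N : ℕ) (T : ℝ≥0), GFM.episodeCount Ω D y ≤ N → GFM.totalOnTime Ω D y ≤ T →
            GFM.GainBoundedBy (fun t => (y t).2.1)
              (B₃ (x₀, zd₀, zq₀, GFM.supNorm vgd, GFM.supNorm vgq, N, T)) ∧
            GFM.GainBoundedBy (fun t => (y t).2.2)
              (B₃ (x₀, zd₀, zq₀, GFM.supNorm vgd, GFM.supNorm vgq, N, T))) := by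
  obtain ⟨B₂, hB₂_cont, hB₂⟩ := GFM.exists_rest_bound Ω D
  obtain ⟨B₃, hB₃⟩ := GFM.exists_gain_bound Ω D
  refine ⟨B₂, hB₂_cont, B₃, fun vgd vgq hd hq x₀ hx₀ zd₀ zq₀ => ?_⟩
  obtain ⟨y, hy, hy0⟩ := GFM.exists_isSolution Ω hd hq (y₀ := (x₀, zd₀, zq₀)) hx₀
  have hsafe : (y 0).1 ∈ GFM.safeSet D := hy0 ▸ hx₀
  have hyT := GFM.isSolution_iff_forall_isSolutionUpTo.1 hy
  refine ⟨y, ⟨hy, hy0⟩, fun y' hy' hy'0 => hy'.eqOn hy (hy'0.trans hy0.symm),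
    fun t ht => ⟨Real.sqrt_le_iff.2 ⟨D.Imax_pos.le, GFM.current_sq_le ht (hyT t ht) hsafe⟩, ?_⟩,
    fun N T hN hT => ?_⟩
  · simpa only [hy0] using hB₂ vgd vgq hd hq t ht y (hyT t ht) hsafe
  · simpa only [hy0] using hB₃ vgd vgq hd hq y hy hsafe N T hN hT
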